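/- **Problem.** Let $f:\mathbb R^n\to\mathbb R$ and $c_i:\mathbb R^n\to\mathbb R$ ($1\le i\le m$) be continuously differentiable and let $0\le\bar m\le m$. Consider minimizing $f(x)$ subject to $c_i(x)=0$ for $i\le\bar m$ and $c_i(x)\le 0$ for $i>\bar m$. Put $v(x)=\sum_{i\le\bar m}|c_i(x)|+\sum_{i>\bar m}(c_i(x))_+$, $\phi(x,\rho)=\rho f(x)+v(x)$, where $(t)_+=\max\{t,0\}$. A KKT point is a feasible $x$ with $\nabla f(x)+\sum_i\eta_i\nabla c_i(x)=0$ for some $\eta$ with $\eta_i\ge0$ and $\eta_ic_i(x)=0$ for $i>\bar m$. An infeasible stationary point is an infeasible $x$ with $0\in\partial v(x)$, i.e. $\sum_i\eta_i\nabla c_i(x)=0$ for some $\eta$ with $\eta_i\in\partial|\cdot|(c_i(x))$ for $i\le\bar m$ and $\eta_i\in\partial(\cdot)_+(c_i(x))$ for $i>\bar m$. MFCQ holds at $x$ if $v(x)=0$, the $\nabla c_i(x)$, $i\le\bar m$, are linearly independent, and some $d$ satisfies $c_i(x)+\langle\nabla c_i(x),d\rangle=0$ for $i\le\bar m$ and $c_i(x)+\langle\nabla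 c_i(x),d\rangle<0$ for $i>\bar m$. **Subproblem.** Let $X\subset\mathbb R^n$ be a fixed set. At iteration $k$ put $g=\nabla f(x^k)$, $a^i=\nabla c_i(x^k)$, $b_i=c_i(x^k)$, and let $H_\rho=\rho H_f+H_0$ with matrices $H_f,H_0$ chosen at iteration $k$. Put $$l(d,\rho)=\rho\langle g,d\rangle+\sum_{i\le\bar m}|b_i+\langle a^i,d\rangle|+\sum_{i>\bar m}(b_i+\langle a^i,d\rangle)_+,\qquad \Delta l(d,\rho)=l(0,\rho)-l(d,\rho),$$ and $J(d,\rho)=l(d,\rho)+\tfrac12\langle d,H_\rho d\rangle+\delta(d|X)$, with $\delta(d|X)=0$ for $d\in X$ and $+\infty$ otherwise. Let $\bar a^i=a^i/\|a^i\|_2$, $\bar b_i=b_i/\|a^i\|_2$, and let $C_i$ be the set of $d$ with $\langle\bar a^i,d\rangle+\bar b_i=0$ ($i\le\bar m$), respectively $\le0$ ($i>\bar m$). Dual variables are tuples $u=(u^0,\dots,u^{m+1})$ of vectors in $\mathbb R^n$; $u$ is dual feasible if $u^0+\sum_{i=1}^m\|a^i\|_2u^i+u^{m+1}=0$ and $\|u^i\|_2\le1$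 for $1\le i\le m$. With the support functions $\delta^*(y|C)=\sup_{d\in C}\langle y,d\rangle$ put $$D(u,\rho)=-\tfrac12\langle u^0-\rho g,H_\rho^{-1}(u^0-\rho g)\rangle-\sum_{i=1}^m\|a^i\|_2\,\delta^*(u^i|C_i)-\delta^*(u^{m+1}|X).$$ Let $\zeta_i(u)=\langle u^i,\bar a^i\rangle$ and let $\chi(d,u)$ be the sum of $(1-\zeta_i(u))\|a^i\|_2\,\mathrm{dist}(d,C_i)$ over all $i$ with $\langle\bar a^i,d\rangle+\bar b_i>0$ and of $(1+\zeta_i(u))\|a^i\|_2\,\mathrm{dist}(d,C_i)$ over all $i\le\bar m$ with $\langle\bar a^i,d\rangle+\bar b_i<0$. **Algorithm.** Let $\gamma,\theta_\rho,\theta_\alpha,\theta_\omega,\beta_v,\beta_\phi\in(0,1)$, $\beta_l\in(0,\beta_\phi(1-\beta_v)]$, $\rho_{-1},\omega_0>0$; choose $x^0,\eta^0$. In iteration $k=0,1,2,\dots$, set $\rho_{(0)}=\rho_{k-1}$ and generate, for $j=0,1,\dots$, triples $(d^{(j)},u^{(j)},w^{(j)})$. With $J_\omega=v(x^k)+\omega_k$,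 consider $$(\mathrm{Rv})\ \frac{J_\omega-l(d^{(j)},0)}{J_\omega-(D(w^{(j)},0))_+}\ge\beta_v,\quad(\mathrm{R}\phi)\ \frac{J_\omega-J(d^{(j)},\rho_{(j)})}{J_\omega-D(u^{(j)},\rho_{(j)})}\ge\beta_\phi,\quad(\mathrm{Rc})\ \chi(d^{(j)},u^{(j)})\le(1-\beta_v)^2J_\omega .$$ If all three hold, the inner loop terminates; if (R$\phi$) and (Rc) hold but (Rv) does not, then $\rho_{(j+1)}=\theta_\rho\rho_{(j)}$ (the update DUST); otherwise $\rho_{(j+1)}=\rho_{(j)}$. At termination set $d^k=d^{(j)}$, $\tilde\rho_k=\rho_{(j)}$. If $\Delta l(d^k,\tilde\rho_k)+\omega_k\ge\beta_l(\Delta l(d^k,0)+\omega_k)$, set $\rho_k=\tilde\rho_k$; otherwise (the update PSST) set $$\rho_k=\frac{(1-\beta_l)(\Delta l(d^k,0)+\omega_k)}{\langle\nabla f(x^k),d^k\rangle+\frac12\langle d^k,H_rd^k\rangle},$$ where $r\in[0,\rho_{k-1}]$ is any value of the penalty parameter (for instance $\tilde\rho_k$, or $\rho_k$ itself). Let $\alpha_k$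 be the largest element of $\{\gamma^0,\gamma^1,\dots\}$ with $\phi(x^k+\alpha_kd^k,\rho_k)-\phi(x^k,\rho_k)\le-\theta_\alpha\alpha_k\Delta l(d^k,\rho_k)$; choose $\omega_{k+1}\in(0,\theta_\omega\omega_k]$ and $\eta^{k+1}\in\mathbb R^m$, and set $x^{k+1}=x^k+\alpha_kd^k$. Let $\mathcal D$ be the set of all $k$ for which DUST reduces the penalty parameter at some inner iteration, and $\mathcal T=\{k:\rho_k<\tilde\rho_k\}$ the set of all $k$ for which PSST reduces it. **Assumptions.** The algorithm generates an infinite sequence (every inner loop terminates) such that, for all $k$: * $H_\rho$ is (symmetric) positive definite for all $\rho\in[0,\rho_{k-1}]$ and $\nabla c_i(x^k)\ne0$ for all $i$; * for all inner iterations $j$: $d^{(j)}\in X$, $J(d^{(j)},\rho_{(j)})\le J(0,\rho_{(j)})$, $D(w^{(j)},0)\ge D(u^{(j)},0)\ge D(u^{(0)},0)>-\infty$, and $u^{(j)},w^{(j)}$ are dual feasible; and the following global assumption holds: $X$ is compact and convex with $0\in\operatorname{int}X$; $f$, all $c_i$ and their first- and second-order derivatives exist and are bounded on an open convex set containing all $x^k$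 and $x^k+d^k$; there are constants $0<\underline\Lambda\le\overline\Lambda$ such that for all $k$ and all $\rho\in[0,\rho_0]$ the eigenvalues of $H_\rho$ lie in $[\underline\Lambda,\overline\Lambda]$; all $u^{(j)},w^{(j)}$ of all iterations $k$ are bounded by one constant; $\{\eta^k\}$ is bounded. **Claim.** At least one of the following occurs. 1. $\rho_k\to\rho_*$ for some $\rho_*>0$, and every limit point of $\{x^k\}$ is a KKT point or an infeasible stationary point. 2. $\rho_k\to0$ and every limit point of $\{x^k\}$ is an infeasible stationary point. 3. $\rho_k\to0$, every limit point of $\{x^k\}$ is feasible, and MFCQ fails at every limit point of $\{x^k\}_{k\in\mathcal D\cup\mathcal T}$. Case 1 excludes cases 2 and 3, and if $\{x^k\}$ has at least one limit point, then cases 2 and 3 exclude each other, so that exactly one of the three cases occurs. -/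

import Mathlib

open Set Filter Topology
open scoped Matrix

noncomputable section

namespace PenaltySQP

/-- Euclidean space of dimension `n`. -/
abbrev Vec (n : ℕ) := EuclideanSpace ℝ (Fin n)

/-! ### The nonlinear optimization problem -/

/-- The problem of minimizing `f x` subject to `c i x = 0` for the first `mbar` indices and
`c i x ≤ 0` for the remaining ones, with continuously differentiable data. -/
structure NLP (n m : ℕ) where
  f : Vec n → ℝ
  c : Fin m → Vec n → ℝ
  mbar : ℕ
  mbar_le : mbar ≤ m
  f_smooth : ContDiff ℝ 1 f
  c_smooth : ∀ i, ContDiff ℝ 1 (c i)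

namespace NLP

variable {n m : ℕ} (P : NLP n m)

/-- The index `i` belongs to an equality constraint. -/
def IsEq (i : Fin m) : Prop := (i : ℕ) < P.mbar

instance (i : Fin m) : Decidable (P.IsEq i) := Nat.decLt _ _

/-- The measure of infeasibility. -/
def v (x : Vec n) : ℝ := ∑ i, if P.IsEq i then |P.c i x| else max (P.c i x) 0

/-- The exact penalty function. -/
def phi (x : Vec n) (ρ : ℝ) : ℝ := ρ * P.f x + P.v x

/-- The Fritz John function. -/
def fritzJohn (x : Vec n) (ρ : ℝ) (η : Vec m) : ℝ := ρ * P.f x + ∑ i, η i * P.c i x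

def Feasible (x : Vec n) : Prop :=
  (∀ i, P.IsEq i → P.c i x = 0) ∧ ∀ i, ¬ P.IsEq i → P.c i x ≤ 0

/-- KKT points of the problem. -/
def IsKKT (x : Vec n) : Prop :=
  P.Feasible x ∧ ∃ η : Vec m, gradient (fun y => P.fritzJohn y 1 η) x = 0 ∧
    ∀ i, ¬ P.IsEq i → 0 ≤ η i ∧ η i * P.c i x = 0

/-- First-order stationarity for `v`, i.e. `0 ∈ ∂v(x)`: some combination of the constraint
gradients vanishes whose `i`-th coefficient is a subgradient at `c i x` of `t ↦ |t|`
(equality constraints) or of `t ↦ max t 0` (inequality constraints). -/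
def IsStationaryForV (x : Vec n) : Prop :=
  ∃ η : Vec m, gradient (fun y => P.fritzJohn y 0 η) x = 0 ∧
    (∀ i, P.IsEq i →
      -1 ≤ η i ∧ η i ≤ 1 ∧ (0 < P.c i x → η i = 1) ∧ (P.c i x < 0 → η i = -1)) ∧
    (∀ i, ¬ P.IsEq i →
      0 ≤ η i ∧ η i ≤ 1 ∧ (0 < P.c i x → η i = 1) ∧ (P.c i x < 0 → η i = 0))

def IsInfeasibleStationary (x : Vec n) : Prop := ¬ P.Feasible x ∧ P.IsStationaryForV x

/-- The Mangasarian-Fromovitz constraint qualification. -/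
def MFCQ (x : Vec n) : Prop :=
  P.v x = 0 ∧
  LinearIndependent ℝ (fun i : {i : Fin m // P.IsEq i} => gradient (P.c i) x) ∧
  ∃ d : Vec n,
    (∀ i, P.IsEq i → P.c i x + inner ℝ (gradient (P.c i) x) d = 0) ∧
    (∀ i, ¬ P.IsEq i → P.c i x + inner ℝ (gradient (P.c i) x) d < 0)

end NLP

/-! ### The subproblem and its dual -/

/-- The quadratic form `⟨d, A d⟩`. -/
def quad {n : ℕ} (A : Matrix (Fin n) (Fin n) ℝ) (d : Vec n) : ℝ :=
  d.ofLp ⬝ᵥ (A *ᵥ d.ofLp)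

/-- The support function `δ*(y | C)` of a set, with values in the extended reals. -/
def supportFn {n : ℕ} (y : Vec n) (C : Set (Vec n)) : EReal :=
  ⨆ d ∈ C, ((inner ℝ y d : ℝ) : EReal)

/-- A tuple `(u⁰, u¹, …, uᵐ, uᵐ⁺¹)` of dual variables: `u0`, `u i`, `uX`. -/
structure DualVar (n m : ℕ) where
  u0 : Vec n
  u : Fin m → Vec n
  uX : Vec n

/-- The Euclidean norm of a tuple of dual variables. -/
def DualVar.norm₂ {n m : ℕ} (w : DualVar n m) : ℝ :=
  Real.sqrt (‖w.u0‖ ^ 2 + ∑ i, ‖w.u i‖ ^ 2 + ‖w.uX‖ ^ 2)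

/-- The data of one subproblem. -/
structure QP (n m : ℕ) where
  mbar : ℕ
  g : Vec n
  a : Fin m → Vec n
  b : Fin m → ℝ
  Hf : Matrix (Fin n) (Fin n) ℝ
  H0 : Matrix (Fin n) (Fin n) ℝ
  X : Set (Vec n)

namespace QP

variable {n m : ℕ} (Q : QP n m)

/-- `H_ρ = ρ H_f + H_0`. -/
def H (ρ : ℝ) : Matrix (Fin n) (Fin n) ℝ := ρ • Q.Hf + Q.H0

/-- The linearized model `l(d, ρ)` of the penalty function. -/
def l (d : Vec n) (ρ : ℝ) : ℝ :=
  ρ * inner ℝ Q.g d +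
    ∑ i : Fin m, if (i : ℕ) < Q.mbar then |Q.b i + inner ℝ (Q.a i) d|
      else max (Q.b i + inner ℝ (Q.a i) d) 0

/-- The reduction `Δl(d, ρ) = l(0, ρ) - l(d, ρ)`. -/
def deltaL (d : Vec n) (ρ : ℝ) : ℝ := Q.l 0 ρ - Q.l d ρ

open Classical in
/-- The model `J(d, ρ) = l(d, ρ) + ½⟨d, H_ρ d⟩ + δ(d | X)`. -/
def J (d : Vec n) (ρ : ℝ) : EReal :=
  ((Q.l d ρ + 1 / 2 * quad (Q.H ρ) d : ℝ) : EReal) + if d ∈ Q.X then 0 else ⊤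

/-- The normalized gradient `a^i / ‖a^i‖`. -/
def abar (i : Fin m) : Vec n := (‖Q.a i‖)⁻¹ • Q.a i

/-- The scaled residual `b_i / ‖a^i‖`. -/
def bbar (i : Fin m) : ℝ := Q.b i / ‖Q.a i‖

/-- The set `C_i` of directions satisfying the `i`-th linearized constraint. -/
def C (i : Fin m) : Set (Vec n) :=
  if (i : ℕ) < Q.mbar then {d | inner ℝ (Q.abar i) d + Q.bbar i = 0}
  else {d | inner ℝ (Q.abar i) d + Q.bbar i ≤ 0}

/-- Feasibility for the Fenchel-Rockafellar dual. -/
def DualFeasible (w : DualVar n m) : Prop :=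
  w.u0 + ∑ i, ‖Q.a i‖ • w.u i + w.uX = 0 ∧ ∀ i, ‖w.u i‖ ≤ 1

/-- The dual objective, with values in the extended reals. -/
def D (w : DualVar n m) (ρ : ℝ) : EReal :=
  ((-(1 / 2) * quad (Q.H ρ)⁻¹ (w.u0 - ρ • Q.g) : ℝ) : EReal)
    - (∑ i, ((‖Q.a i‖ : ℝ) : EReal) * supportFn (w.u i) (Q.C i))
    - supportFn w.uX Q.X

/-- `ζ_i(u) = ⟨u^i, abar^i⟩`. -/
def zeta (w : DualVar n m) (i : Fin m) : ℝ := inner ℝ (w.u i) (Q.abar i)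

/-- The complementarity measure `χ(d, u)`. -/
def chi (d : Vec n) (w : DualVar n m) : ℝ :=
  ∑ i : Fin m,
    if 0 < inner ℝ (Q.abar i) d + Q.bbar i then
      (1 - Q.zeta w i) * ‖Q.a i‖ * Metric.infDist d (Q.C i)
    else if (i : ℕ) < Q.mbar ∧ inner ℝ (Q.abar i) d + Q.bbar i < 0 then
      (1 + Q.zeta w i) * ‖Q.a i‖ * Metric.infDist d (Q.C i)
    else 0

/-- `J⁽⁰⁾ = J(0, ρ) = l(0, 0)`, the same number for every `ρ` as soon as `0 ∈ X`. -/
def Jzero : ℝ := Q.l 0 0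

/-- The ratio `r_v`. -/
def rv (ω : ℝ) (d : Vec n) (w : DualVar n m) : ℝ :=
  (Q.Jzero + ω - Q.l d 0) / (Q.Jzero + ω - max (Q.D w 0).toReal 0)

/-- The ratio `r_φ`. -/
def rphi (ω ρ : ℝ) (d : Vec n) (u : DualVar n m) : ℝ :=
  (Q.Jzero + ω - (Q.J d ρ).toReal) / (Q.Jzero + ω - (Q.D u ρ).toReal)

end QP

/-! ### The algorithm -/

/-- The constants required by the algorithm. -/
structure Params where
  γ : ℝ
  θρ : ℝ
  θα : ℝ
  θω : ℝ
  βv : ℝ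
  βφ : ℝ
  βl : ℝ
  ρinit : ℝ
  ωinit : ℝ
  γ_mem : γ ∈ Ioo (0 : ℝ) 1
  θρ_mem : θρ ∈ Ioo (0 : ℝ) 1
  θα_mem : θα ∈ Ioo (0 : ℝ) 1
  θω_mem : θω ∈ Ioo (0 : ℝ) 1
  βv_mem : βv ∈ Ioo (0 : ℝ) 1
  βφ_mem : βφ ∈ Ioo (0 : ℝ) 1
  βl_mem : βl ∈ Ioc (0 : ℝ) (βφ * (1 - βv))
  ρinit_pos : 0 < ρinit
  ωinit_pos : 0 < ωinit

/-- All quantities produced by the algorithm. Quantities of the `k`-th subproblem solve carry the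
inner index `j`; only the values with `j ≤ jEnd k` are meaningful, where `jEnd k` is the inner
iteration at which the `k`-th subproblem solve terminates. The matrices `Hf k`, `H0 k` are the
Hessian approximations used in iteration `k` (they may depend on `x k`, `η k` and on the past in
any way). -/
structure Trajectory (n m : ℕ) where
  x : ℕ → Vec n
  η : ℕ → Vec m
  ω : ℕ → ℝ
  ρ : ℕ → ℝ
  α : ℕ → ℝ
  Hf : ℕ → Matrix (Fin n) (Fin n) ℝ
  H0 : ℕ → Matrix (Fin n) (Fin n) ℝ
  jEnd : ℕ → ℕ
  dIn : ℕ → ℕ → Vec n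
  uIn : ℕ → ℕ → DualVar n m
  wIn : ℕ → ℕ → DualVar n m
  ρIn : ℕ → ℕ → ℝ

namespace Trajectory

variable {n m : ℕ} (T : Trajectory n m)

/-- `ρ_{k-1}`, with the prescribed initial value `ρ_{-1}` for `k = 0`. -/
def ρprev (p : Params) : ℕ → ℝ
  | 0 => p.ρinit
  | k + 1 => T.ρ k

/-- The search direction `d^k`: the final inner iterate. -/
def d (k : ℕ) : Vec n := T.dIn k (T.jEnd k)

/-- The penalty parameter at the end of the `k`-th subproblem solve. -/
def ρtilde (k : ℕ) : ℝ := T.ρIn k (T.jEnd k)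

/-- The `k`-th subproblem. -/
def qp (P : NLP n m) (X : Set (Vec n)) (k : ℕ) : QP n m where
  mbar := P.mbar
  g := gradient P.f (T.x k)
  a := fun i => gradient (P.c i) (T.x k)
  b := fun i => P.c i (T.x k)
  Hf := T.Hf k
  H0 := T.H0 k
  X := X

/-- Condition (Rv) at inner iteration `j` of iteration `k`. -/
def Rv (P : NLP n m) (X : Set (Vec n)) (p : Params) (k j : ℕ) : Prop :=
  p.βv ≤ (T.qp P X k).rv (T.ω k) (T.dIn k j) (T.wIn k j)

/-- Condition (Rphi) at inner iteration `j` of iteration `k`. -/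
def Rphi (P : NLP n m) (X : Set (Vec n)) (p : Params) (k j : ℕ) : Prop :=
  p.βφ ≤ (T.qp P X k).rphi (T.ω k) (T.ρIn k j) (T.dIn k j) (T.uIn k j)

/-- Condition (Rc) at inner iteration `j` of iteration `k`. -/
def Rc (P : NLP n m) (X : Set (Vec n)) (p : Params) (k j : ℕ) : Prop :=
  (T.qp P X k).chi (T.dIn k j) (T.uIn k j) ≤ (1 - p.βv) ^ 2 * ((T.qp P X k).Jzero + T.ω k)

/-- The sufficient model reduction condition
`Δl(d^k, r; x^k) + ω_k ≥ β_l (Δl(d^k, 0; x^k) + ω_k)` for the penalty parameter value `r`. -/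
def DustAfter (P : NLP n m) (X : Set (Vec n)) (p : Params) (k : ℕ) (r : ℝ) : Prop :=
  p.βl * ((T.qp P X k).deltaL (T.d k) 0 + T.ω k) ≤ (T.qp P X k).deltaL (T.d k) r + T.ω k

/-- The trajectory is a run of the penalty-SQP algorithm with dynamic penalty parameter updating
and parameters `p`, applied to the problem `P` with the set `X`. -/
structure IsRun (P : NLP n m) (X : Set (Vec n)) (p : Params) : Prop where
  /-- The inner loop starts from the penalty parameter of the preceding iteration. -/
  inner_start : ∀ k, T.ρIn k 0 = T.ρprev p k
  /-- The inner loop ends when all three conditions hold, and not before. -/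
  inner_end : ∀ k, T.Rphi P X p k (T.jEnd k) ∧ T.Rc P X p k (T.jEnd k) ∧ T.Rv P X p k (T.jEnd k)
  inner_continue : ∀ k, ∀ j < T.jEnd k, ¬ (T.Rphi P X p k j ∧ T.Rc P X p k j ∧ T.Rv P X p k j)
  /-- The dynamic updating strategy (DUST). -/
  dust_update : ∀ k, ∀ j < T.jEnd k,
    T.Rphi P X p k j → T.Rc P X p k j → ¬ T.Rv P X p k j →
      T.ρIn k (j + 1) = p.θρ * T.ρIn k j
  dust_keep : ∀ k, ∀ j < T.jEnd k,
    ¬ (T.Rphi P X p k j ∧ T.Rc P X p k j) → T.ρIn k (j + 1) = T.ρIn k j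
  /-- The posterior strategy (PSST). The value `r` at which the Hessian approximation in the
  denominator is evaluated may be any value in `[0, ρ_{k-1}]`, for instance the value of the penalty
  parameter before or after this update. -/
  psst_keep : ∀ k, T.DustAfter P X p k (T.ρtilde k) → T.ρ k = T.ρtilde k
  psst_update : ∀ k, ¬ T.DustAfter P X p k (T.ρtilde k) →
    ∃ r ∈ Icc 0 (T.ρprev p k),
      T.ρ k = (1 - p.βl) * ((T.qp P X k).deltaL (T.d k) 0 + T.ω k) /
        (inner ℝ (gradient P.f (T.x k)) (T.d k) + 1 / 2 * quad ((T.qp P X k).H r) (T.d k))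
  /-- The backtracking line search. -/
  line_search : ∀ k, IsGreatest
    {a : ℝ | (∃ i : ℕ, a = p.γ ^ i) ∧
      P.phi (T.x k + a • T.d k) (T.ρ k) - P.phi (T.x k) (T.ρ k)
        ≤ -(p.θα * a * (T.qp P X k).deltaL (T.d k) (T.ρ k))} (T.α k)
  omega_zero : T.ω 0 = p.ωinit
  omega_succ : ∀ k, T.ω (k + 1) ∈ Ioc 0 (p.θω * T.ω k)
  x_succ : ∀ k, T.x (k + 1) = T.x k + T.α k • T.d k

/-- The standing assumption on the subproblem data. -/
structure SubproblemAssumption (P : NLP n m) (X : Set (Vec n)) (p : Params) : Prop where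
  posDef : ∀ k, ∀ r ∈ Icc 0 (T.ρprev p k), ((T.qp P X k).H r).PosDef
  grad_pos : ∀ k i, 0 < ‖gradient (P.c i) (T.x k)‖

/-- The standing assumption on the iterates of the subproblem solver. -/
structure SolverAssumption (P : NLP n m) (X : Set (Vec n)) : Prop where
  primal_mem : ∀ k, ∀ j ≤ T.jEnd k, T.dIn k j ∈ X
  primal_no_worse : ∀ k, ∀ j ≤ T.jEnd k,
    (T.qp P X k).J (T.dIn k j) (T.ρIn k j) ≤ (T.qp P X k).J 0 (T.ρIn k j)
  dual_no_worse : ∀ k, ∀ j ≤ T.jEnd k,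
    (T.qp P X k).D (T.uIn k j) 0 ≤ (T.qp P X k).D (T.wIn k j) 0 ∧
    (T.qp P X k).D (T.uIn k 0) 0 ≤ (T.qp P X k).D (T.uIn k j) 0
  dual_start : ∀ k, ⊥ < (T.qp P X k).D (T.uIn k 0) 0
  dual_feasible : ∀ k, ∀ j ≤ T.jEnd k,
    (T.qp P X k).DualFeasible (T.uIn k j) ∧ (T.qp P X k).DualFeasible (T.wIn k j)

/-- `h` is twice differentiable on `U` (for a function that is known to be differentiable), and `h`
and its first- and second-order derivatives are bounded on `U`. -/
def BoundedDerivs (h : Vec n → ℝ) (U : Set (Vec n)) : Prop :=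
  (∀ y ∈ U, DifferentiableAt ℝ (gradient h) y) ∧
  ∃ M : ℝ, ∀ y ∈ U, |h y| ≤ M ∧ ‖gradient h y‖ ≤ M ∧ ‖fderiv ℝ (gradient h) y‖ ≤ M

/-- The global assumption. -/
structure GlobalAssumption (P : NLP n m) (X : Set (Vec n)) : Prop where
  X_compact : IsCompact X
  X_convex : Convex ℝ X
  zero_mem : (0 : Vec n) ∈ interior X
  /-- (i) -/
  bounded : ∃ U : Set (Vec n), IsOpen U ∧ Convex ℝ U ∧
    (∀ k, T.x k ∈ U ∧ T.x k + T.d k ∈ U) ∧ BoundedDerivs P.f U ∧ ∀ i, BoundedDerivs (P.c i) U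
  /-- (ii) the eigenvalues of all `H_ρ`, including `ρ = 0`, lie in a compact subset of `(0, ∞)` -/
  eigenvalues : ∃ Λlo Λhi : ℝ, 0 < Λlo ∧ Λlo ≤ Λhi ∧
    ∀ k, ∀ r ∈ Icc 0 (T.ρ 0), spectrum ℝ ((T.qp P X k).H r) ⊆ Icc Λlo Λhi
  /-- (iii) -/
  dual_bounded : ∃ K : ℝ, ∀ k, ∀ j ≤ T.jEnd k, (T.uIn k j).norm₂ ≤ K ∧ (T.wIn k j).norm₂ ≤ K
  /-- (iv) -/
  grad_pos : ∀ k i, 0 < ‖gradient (P.c i) (T.x k)‖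
  /-- (v) -/
  eta_bounded : ∃ K : ℝ, ∀ k, ‖T.η k‖ ≤ K

/-- The set `𝒰ᵏ` of inner iterations at which the penalty parameter is reduced by (DUST). -/
def dustSet (P : NLP n m) (X : Set (Vec n)) (p : Params) (k : ℕ) : Set ℕ :=
  {j | j ≤ T.jEnd k ∧ T.Rphi P X p k j ∧ T.Rc P X p k j ∧ ¬ T.Rv P X p k j}

/-- The index set `𝒟` of the iterations in which (DUST) reduces the penalty parameter. -/
def setD (P : NLP n m) (X : Set (Vec n)) (p : Params) : Set ℕ :=
  {k | (T.dustSet P X p k).Nonempty}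

/-- The index set `𝒯` of the iterations in which (PSST) reduces the penalty parameter. -/
def setT : Set ℕ := {k | T.ρ k < T.ρtilde k}

/-- `z` is a limit point of the subsequence of `x` with indices in `S`. -/
def IsLimitPoint (S : Set ℕ) (z : Vec n) : Prop :=
  ∃ s : ℕ → ℕ, StrictMono s ∧ (∀ j, s j ∈ S) ∧ Tendsto (fun j => T.x (s j)) atTop (𝓝 z)

/-- The first alternative. -/
def CaseI (P : NLP n m) : Prop :=
  (∃ ρstar : ℝ, 0 < ρstar ∧ Tendsto T.ρ atTop (𝓝 ρstar)) ∧
  ∀ z, T.IsLimitPoint univ z → P.IsKKT z ∨ P.IsInfeasibleStationary z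

/-- The second alternative. -/
def CaseII (P : NLP n m) : Prop :=
  Tendsto T.ρ atTop (𝓝 0) ∧ ∀ z, T.IsLimitPoint univ z → P.IsInfeasibleStationary z

/-- The third alternative. -/
def CaseIII (P : NLP n m) (X : Set (Vec n)) (p : Params) : Prop :=
  Tendsto T.ρ atTop (𝓝 0) ∧ (∀ z, T.IsLimitPoint univ z → P.Feasible z) ∧
  ∀ z, T.IsLimitPoint (T.setD P X p ∪ T.setT) z → ¬ P.MFCQ z

end Trajectory

end PenaltySQP

end

/-! The penalty parameters are positive and nonincreasing, so they converge, and the cases are split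
by their limit. Two facts carry the proof: the steps `d^k` tend to zero, and a vanishing duality gap
turns dual variables into multipliers.

For the steps: PSST reduces the parameter only when `⟨∇f, d⟩ > 0`, and then the reduction raises
`Δl`; hence `Δl(d^k, ρ_k)` still dominates a fixed multiple of `‖d^k‖²`. As `Δl` is accurate to
second order, the step sizes are bounded below. With `|f| ≤ M` along the iterates, `ρ_k (f + M) + v`
is nonincreasing from `k = 1` on and bounded below, so its decrements, and with them `d^k`, tend to
zero (`exists_le_α`, `exists_tendsto_merit`).

For the multipliers: a finite dual value forces `u^i = ζ_i abar^i`, with `ζ_i ≥ 0` for inequalities,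
and with `τ` the radius of a ball around 0 inside `X`, `D(u, ρ) ≤ -½⟨u⁰ - ρg, H_ρ⁻¹(u⁰ - ρg)⟩ + ∑
ζ_i b_i - τ‖u^{m+1}‖ ≤ v`. If `v - D → 0`, then `u⁰ - ρg` and `u^{m+1}` vanish in the limit, and
limits of `ζ` satisfy `ρ∇f + ∑ ζ_i ∇c_i = 0` with every `ζ_i c_i` equal to the violation
(`exists_isMultiplier_of_gap`). Since `d^k → 0`, condition (Rv) closes the gap for `ρ = 0` at
infeasible limit points, and (Rφ) closes it for the current parameter. This gives stationarity for
`v`, respectively KKT points when the limit parameter is positive.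

If `ρ_k → 0`, then `v(x^k)` converges. A nonzero limit makes all limit points infeasible and hence
stationary. If the limit is zero, all limit points are feasible; moreover each reduction supplies a
dual variable with some `|ζ_i| ≥ β_v` whose gap vanishes (`exists_large_zeta`). Its limit is a
nonzero multiplier with `ρ = 0`, which MFCQ forbids (`IsMultiplier.eq_zero_of_mfcq`). -/

namespace PenaltySQP

variable {n m : ℕ}

/-! ### Violation of a single constraint -/

/-- The violation of an equality constraint (if `e` holds) or of an inequality constraint with
residual `t`. -/
noncomputable def viol (e : Prop) [Decidable e] (t : ℝ) : ℝ := if e then |t| else max t 0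

section viol

variable (e : Prop) [Decidable e]

theorem viol_nonneg (t : ℝ) : 0 ≤ viol e t := by
  unfold viol; split_ifs <;> simp

theorem viol_le_add_abs_sub (s t : ℝ) : viol e s ≤ viol e t + |s - t| := by
  unfold viol; split_ifs
  · have := abs_sub_abs_le_abs_sub s t
    linarith
  · have h1 := le_abs_self (s - t)
    have h2 := le_max_left t 0
    exact max_le (by linarith) (add_nonneg (le_max_right _ _) (abs_nonneg _))

theorem viol_convex (s t : ℝ) {a : ℝ} (h0 : 0 ≤ a) (h1 : a ≤ 1) :
    viol e (s + a * t) ≤ (1 - a) * viol e s + a * viol e (s + t) := by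
  have hs : s + a * t = (1 - a) * s + a * (s + t) := by ring
  have h1' : 0 ≤ 1 - a := sub_nonneg.2 h1
  unfold viol; split_ifs
  · rw [hs]
    refine (abs_add_le _ _).trans_eq ?_
    rw [abs_mul, abs_mul, abs_of_nonneg h0, abs_of_nonneg h1']
  · have h2 := mul_le_mul_of_nonneg_left (le_max_left s 0) h1'
    have h3 := mul_le_mul_of_nonneg_left (le_max_left (s + t) 0) h0
    have h4 := mul_nonneg h1' (le_max_right s 0)
    have h5 := mul_nonneg h0 (le_max_right (s + t) 0)
    exact max_le (by linarith) (by linarith)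

theorem mul_le_abs_mul_viol {z : ℝ} (hz : ¬ e → 0 ≤ z) (t : ℝ) : z * t ≤ |z| * viol e t := by
  unfold viol; split_ifs with he
  · rw [← abs_mul]; exact le_abs_self _
  · rw [abs_of_nonneg (hz he)]
    exact mul_le_mul_of_nonneg_left (le_max_left _ _) (hz he)

theorem mul_le_viol {z : ℝ} (h1 : |z| ≤ 1) (hz : ¬ e → 0 ≤ z) (t : ℝ) : z * t ≤ viol e t :=
  (mul_le_abs_mul_viol e hz t).trans (mul_le_of_le_one_left (viol_nonneg e t) h1)

theorem continuous_viol : Continuous (viol e) := by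
  unfold viol; split_ifs <;> fun_prop

end viol

/-! ### Quadratic forms -/

/-- The eigenvalues of `A - c I` are those of `A` shifted by `c`, hence nonnegative, so this matrix
is positive semidefinite. -/
theorem mul_norm_sq_le_quad {A : Matrix (Fin n) (Fin n) ℝ} (hA : A.IsHermitian) {c : ℝ}
    (h : ∀ t ∈ spectrum ℝ A, c ≤ t) (d : Vec n) : c * ‖d‖ ^ 2 ≤ quad A d := by
  have hB : (A - algebraMap ℝ _ c).IsHermitian := by
    refine hA.sub ?_
    rw [Matrix.algebraMap_eq_diagonal]
    exact Matrix.isHermitian_diagonal _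
  have hpos : (A - algebraMap ℝ _ c).PosSemidef := by
    rw [hB.posSemidef_iff_eigenvalues_nonneg]
    intro i
    have hi := hB.eigenvalues_mem_spectrum_real i
    rw [← spectrum.sub_singleton_eq, Set.mem_sub] at hi
    obtain ⟨t, ht, s, hs, hts⟩ := hi
    rw [Set.mem_singleton_iff] at hs
    have := h t ht
    show (0 : ℝ) ≤ _
    rw [← hts, hs]; linarith
  have h2 := (Matrix.posSemidef_iff_dotProduct_mulVec.1 hpos).2 d.ofLp
  rw [Matrix.sub_mulVec, dotProduct_sub, Algebra.algebraMap_eq_smul_one, Matrix.smul_mulVec,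
    Matrix.one_mulVec, dotProduct_smul] at h2
  have h3 : star d.ofLp ⬝ᵥ d.ofLp = ‖d‖ ^ 2 := by
    rw [EuclideanSpace.real_norm_sq_eq]
    simp [dotProduct, pow_two]
  rw [h3] at h2
  simp only [star_trivial, smul_eq_mul] at h2
  unfold quad
  linarith

theorem quad_nonneg {A : Matrix (Fin n) (Fin n) ℝ} (hA : A.PosDef) (d : Vec n) : 0 ≤ quad A d := by
  simpa [quad] using (Matrix.posSemidef_iff_dotProduct_mulVec.1 hA.posSemidef).2 d.ofLp

/-- The spectrum of `A⁻¹` consists of the reciprocals of the positive eigenvalues of `A`, which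
reduces the claim to `mul_norm_sq_le_quad`. -/
theorem mul_norm_sq_le_quad_inv {A : Matrix (Fin n) (Fin n) ℝ} (hA : A.PosDef) {c : ℝ}
    (h : ∀ t ∈ spectrum ℝ A, t ≤ c) (d : Vec n) : c⁻¹ * ‖d‖ ^ 2 ≤ quad A⁻¹ d := by
  refine mul_norm_sq_le_quad hA.isHermitian.inv (fun t ht => ?_) d
  have hu := hA.isUnit
  obtain ⟨U, hU⟩ := hu
  have hinv : A⁻¹ = ((U⁻¹ : (Matrix (Fin n) (Fin n) ℝ)ˣ) : Matrix (Fin n) (Fin n) ℝ) := by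
    rw [← hU, Matrix.coe_units_inv]
  rw [hinv, ← spectrum.inv₀_mem_iff, hU] at ht
  have hpos : 0 < t⁻¹ := by
    rw [hA.isHermitian.spectrum_real_eq_range_eigenvalues] at ht
    obtain ⟨i, hi⟩ := ht
    rw [← hi]; exact hA.eigenvalues_pos i
  have := h _ ht
  have ht0 : 0 < t := inv_pos.1 hpos
  exact inv_le_of_inv_le₀ ht0 this

/-! ### Support functions -/

theorem inner_le_supportFn {C : Set (Vec n)} {d : Vec n} (hd : d ∈ C) (y : Vec n) :
    ((inner ℝ y d : ℝ) : EReal) ≤ supportFn y C :=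
  le_iSup₂ (f := fun d (_ : d ∈ C) => ((inner ℝ y d : ℝ) : EReal)) d hd

theorem mul_norm_le_supportFn {X : Set (Vec n)} {r : ℝ} (hr : 0 ≤ r)
    (hX : Metric.closedBall 0 r ⊆ X) (y : Vec n) :
    ((r * ‖y‖ : ℝ) : EReal) ≤ supportFn y X := by
  -- The maximizer of `⟨y, ·⟩` over the ball; for `y = 0` the convention `0⁻¹ = 0` makes it the
  -- origin.
  have hmem : (r * ‖y‖⁻¹) • y ∈ X := by
    apply hX
    rw [mem_closedBall_zero_iff, norm_smul, Real.norm_eq_abs, abs_of_nonneg (by positivity)]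
    rcases eq_or_ne ‖y‖ 0 with h | h
    · simp [h, hr]
    · rw [mul_assoc, inv_mul_cancel₀ h, mul_one]
  refine le_trans (le_of_eq ?_) (inner_le_supportFn hmem y)
  congr 1
  rw [inner_smul_right, real_inner_self_eq_norm_sq]
  rcases eq_or_ne ‖y‖ 0 with h | h
  · simp [h]
  · field_simp

theorem exists_real_bound_of_supportFn_ne_top {C : Set (Vec n)} {y : Vec n}
    (h : supportFn y C ≠ ⊤) : ∃ s : ℝ, ∀ d ∈ C, inner ℝ y d ≤ s := by
  refine ⟨(supportFn y C).toReal, fun d hd => ?_⟩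
  have h1 := inner_le_supportFn hd y
  have h2 := EReal.toReal_le_toReal h1 (EReal.coe_ne_bot _) h
  simpa using h2

theorem nonpos_of_forall_mul_le {a s : ℝ} (h : ∀ t : ℝ, 0 ≤ t → a * t ≤ s) : a ≤ 0 := by
  by_contra ha
  push Not at ha
  have h0 := h ((|s| + 1) / a) (by positivity)
  rw [mul_div_cancel₀ _ ha.ne'] at h0
  linarith [le_abs_self s]

theorem coe_sum {ι : Type*} (s : Finset ι) (f : ι → ℝ) :
    ((∑ i ∈ s, f i : ℝ) : EReal) = ∑ i ∈ s, (f i : EReal) := by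
  classical
  induction s using Finset.induction_on with
  | empty => simp
  | insert i s hi ih => rw [Finset.sum_insert hi, Finset.sum_insert hi, EReal.coe_add, ih]

namespace QP

variable (Q : QP n m)

theorem l_eq (d : Vec n) (ρ : ℝ) :
    Q.l d ρ = ρ * inner ℝ Q.g d +
      ∑ i : Fin m, viol ((i : ℕ) < Q.mbar) (Q.b i + inner ℝ (Q.a i) d) := rfl

theorem norm_abar {i : Fin m} (ha : 0 < ‖Q.a i‖) : ‖Q.abar i‖ = 1 := by
  rw [abar, norm_smul, norm_inv, norm_norm, inv_mul_cancel₀ ha.ne']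

theorem inner_abar_self {i : Fin m} (ha : 0 < ‖Q.a i‖) :
    inner ℝ (Q.abar i) (Q.abar i) = (1 : ℝ) := by
  rw [real_inner_self_eq_norm_sq, Q.norm_abar ha, one_pow]

theorem norm_mul_residual {i : Fin m} (ha : 0 < ‖Q.a i‖) (d : Vec n) :
    ‖Q.a i‖ * (inner ℝ (Q.abar i) d + Q.bbar i) = Q.b i + inner ℝ (Q.a i) d := by
  rw [abar, bbar, inner_smul_left]
  simp only [map_inv₀, conj_trivial]
  field_simp
  ring

theorem mem_C_of_residual_eq_zero {i : Fin m} {d : Vec n}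
    (h : inner ℝ (Q.abar i) d + Q.bbar i = 0) : d ∈ Q.C i := by
  unfold C; split_ifs
  · exact h
  · exact h.le

theorem neg_bbar_smul_add_mem_C {i : Fin m} (ha : 0 < ‖Q.a i‖) {y : Vec n}
    (hy : inner ℝ (Q.abar i) y = (0 : ℝ)) : -Q.bbar i • Q.abar i + y ∈ Q.C i := by
  apply Q.mem_C_of_residual_eq_zero
  rw [inner_add_right, inner_smul_right, Q.inner_abar_self ha, hy]
  ring

theorem C_nonempty {i : Fin m} (ha : 0 < ‖Q.a i‖) : (Q.C i).Nonempty :=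
  ⟨_, Q.neg_bbar_smul_add_mem_C ha (inner_zero_right _)⟩

theorem neg_zeta_mul_le_supportFn (w : DualVar n m) {i : Fin m} (ha : 0 < ‖Q.a i‖) :
    ((-(Q.zeta w i * Q.bbar i) : ℝ) : EReal) ≤ supportFn (w.u i) (Q.C i) := by
  refine le_trans (le_of_eq ?_)
    (inner_le_supportFn (Q.neg_bbar_smul_add_mem_C ha (inner_zero_right _)) (w.u i))
  congr 1
  rw [add_zero, inner_smul_right, zeta]
  ring

/-- A dual variable at which the support function of `C_i` is finite is a multiple of the
normalized gradient. -/
theorem u_eq_of_supportFn_ne_top (w : DualVar n m) {i : Fin m} (ha : 0 < ‖Q.a i‖)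
    (h : supportFn (w.u i) (Q.C i) ≠ ⊤) : w.u i = Q.zeta w i • Q.abar i := by
  obtain ⟨s, hs⟩ := exists_real_bound_of_supportFn_ne_top h
  -- The component of `u^i` orthogonal to `abar^i`. Points of `C_i` can be moved along it without
  -- leaving `C_i`, so a bounded supremum forces it to vanish.
  set y := w.u i - Q.zeta w i • Q.abar i with hy
  have horth : inner ℝ (Q.abar i) y = (0 : ℝ) := by
    rw [hy, inner_sub_right, inner_smul_right, Q.inner_abar_self ha, zeta, real_inner_comm]
    ring
  have hself : inner ℝ (w.u i) y = ‖y‖ ^ 2 := by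
    have h1 : w.u i = y + Q.zeta w i • Q.abar i := by rw [hy]; abel
    conv_lhs => rw [h1, inner_add_left, inner_smul_left, horth, real_inner_self_eq_norm_sq]
    simp
  have hle : ‖y‖ ^ 2 ≤ 0 := by
    refine nonpos_of_forall_mul_le (s := s + Q.zeta w i * Q.bbar i) (fun t _ => ?_)
    have h1 := hs _ (Q.neg_bbar_smul_add_mem_C ha (y := t • y)
      (by rw [inner_smul_right, horth, mul_zero]))
    rw [inner_add_right, inner_smul_right, inner_smul_right, hself] at h1
    unfold zeta
    linarith
  have h0 : y = 0 := by
    have := pow_eq_zero_iff (two_ne_zero) |>.1 (le_antisymm hle (sq_nonneg _))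
    exact norm_eq_zero.1 this
  exact sub_eq_zero.1 h0

theorem zeta_nonneg_of_supportFn_ne_top (w : DualVar n m) {i : Fin m} (ha : 0 < ‖Q.a i‖)
    (h : supportFn (w.u i) (Q.C i) ≠ ⊤) (hi : ¬ (i : ℕ) < Q.mbar) : 0 ≤ Q.zeta w i := by
  obtain ⟨s, hs⟩ := exists_real_bound_of_supportFn_ne_top h
  rw [← neg_nonpos]
  refine nonpos_of_forall_mul_le (s := s + Q.zeta w i * Q.bbar i) (fun t ht => ?_)
  -- The half-space contains the ray in direction `-abar^i`, on which `⟨u^i, ·⟩` has slope `-ζ_i`.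
  have h1 := hs ((-Q.bbar i - t) • Q.abar i) (by
    rw [C, if_neg hi, mem_ofPred_eq, inner_smul_right, Q.inner_abar_self ha]
    linarith)
  rw [inner_smul_right] at h1
  unfold zeta
  linarith

theorem abs_zeta_le_one (w : DualVar n m) {i : Fin m} (ha : 0 < ‖Q.a i‖) (hw : ‖w.u i‖ ≤ 1) :
    |Q.zeta w i| ≤ 1 := by
  refine (abs_real_inner_le_norm _ _).trans ?_
  rw [Q.norm_abar ha, mul_one]; exact hw

theorem term_ne_bot (w : DualVar n m) {i : Fin m} (ha : 0 < ‖Q.a i‖) :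
    ((‖Q.a i‖ : ℝ) : EReal) * supportFn (w.u i) (Q.C i) ≠ ⊥ := by
  intro h
  have h1 := mul_le_mul_of_nonneg_left (Q.neg_zeta_mul_le_supportFn w ha)
    (EReal.coe_nonneg.2 ha.le)
  rw [h, ← EReal.coe_mul] at h1
  exact EReal.coe_ne_bot _ (le_bot_iff.1 h1)

theorem finite_of_D_ne_bot (ha : ∀ i, 0 < ‖Q.a i‖) {w : DualVar n m} {ρ : ℝ} (h : Q.D w ρ ≠ ⊥) :
    (∀ i, supportFn (w.u i) (Q.C i) ≠ ⊤) ∧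
      (∑ i, ((‖Q.a i‖ : ℝ) : EReal) * supportFn (w.u i) (Q.C i)) ≠ ⊤ ∧
      supportFn w.uX Q.X ≠ ⊤ := by
  unfold D at h
  rw [sub_eq_add_neg, sub_eq_add_neg, Ne, EReal.add_eq_bot_iff, EReal.add_eq_bot_iff,
    EReal.neg_eq_bot_iff, EReal.neg_eq_bot_iff] at h
  push Not at h
  refine ⟨fun i hi => h.1.2 ?_, h.1.2, h.2⟩
  -- In `EReal` one has `⊤ + ⊥ = ⊥`, so one infinite term makes the sum infinite only because no
  -- other term is `⊥`; this holds since every `C_i` is nonempty.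
  rw [← Finset.add_sum_erase _ _ (Finset.mem_univ i), hi, EReal.coe_mul_top_of_pos (ha i)]
  refine EReal.top_add_of_ne_bot ?_
  refine Finset.sum_induction _ (fun x => x ≠ ⊥) (fun x y hx hy => ?_) (by simp)
    (fun j _ => Q.term_ne_bot w (ha j))
  rw [Ne, EReal.add_eq_bot_iff]; tauto

/-- Only the support functions can be infinite, and they do not involve `ρ`. -/
theorem D_ne_bot_of_D_ne_bot (ha : ∀ i, 0 < ‖Q.a i‖) {w : DualVar n m} {ρ : ℝ}
    (h : Q.D w ρ ≠ ⊥) (ρ' : ℝ) : Q.D w ρ' ≠ ⊥ := by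
  obtain ⟨-, h1, h2⟩ := Q.finite_of_D_ne_bot ha h
  unfold D
  rw [sub_eq_add_neg, sub_eq_add_neg, Ne, EReal.add_eq_bot_iff, EReal.add_eq_bot_iff,
    EReal.neg_eq_bot_iff, EReal.neg_eq_bot_iff]
  simp only [EReal.coe_ne_bot, false_or]
  tauto

/-- The upper bound for the dual objective in terms of the multipliers `ζ_i`. -/
theorem D_toReal_le (ha : ∀ i, 0 < ‖Q.a i‖) {w : DualVar n m} {ρ r : ℝ} (h : Q.D w ρ ≠ ⊥)
    (hr : 0 ≤ r) (hX : Metric.closedBall 0 r ⊆ Q.X) :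
    (Q.D w ρ).toReal ≤ -(1 / 2) * quad (Q.H ρ)⁻¹ (w.u0 - ρ • Q.g) + ∑ i, Q.zeta w i * Q.b i
      - r * ‖w.uX‖ := by
  have hsum : ((-∑ i, Q.zeta w i * Q.b i : ℝ) : EReal) ≤
      ∑ i, ((‖Q.a i‖ : ℝ) : EReal) * supportFn (w.u i) (Q.C i) := by
    have h1 : ((-∑ i, Q.zeta w i * Q.b i : ℝ) : EReal) =
        ∑ i, ((‖Q.a i‖ : ℝ) : EReal) * ((-(Q.zeta w i * Q.bbar i) : ℝ) : EReal) := by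
      rw [← Finset.sum_neg_distrib]
      rw [coe_sum]
      refine Finset.sum_congr rfl (fun i _ => ?_)
      rw [← EReal.coe_mul]
      congr 1
      have := (ha i).ne'
      unfold bbar
      field_simp
    rw [h1]
    exact Finset.sum_le_sum fun i _ => mul_le_mul_of_nonneg_left
      (Q.neg_zeta_mul_le_supportFn w (ha i)) (EReal.coe_nonneg.2 (ha i).le)
  have hle : Q.D w ρ ≤ ((-(1 / 2) * quad (Q.H ρ)⁻¹ (w.u0 - ρ • Q.g) : ℝ) : EReal)
      - ((-∑ i, Q.zeta w i * Q.b i : ℝ) : EReal) - ((r * ‖w.uX‖ : ℝ) : EReal) :=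
    EReal.sub_le_sub (EReal.sub_le_sub le_rfl hsum) (mul_norm_le_supportFn hr hX _)
  rw [← EReal.coe_sub, ← EReal.coe_sub] at hle
  have h3 := EReal.toReal_le_toReal hle h (EReal.coe_ne_top _)
  rw [EReal.toReal_coe] at h3
  linarith

/-- The dual feasibility equation in terms of the multipliers `ζ_i`. -/
theorem dualFeasible_zeta (ha : ∀ i, 0 < ‖Q.a i‖) {w : DualVar n m} {ρ : ℝ} (h : Q.D w ρ ≠ ⊥)
    (hw : Q.DualFeasible w) : w.u0 + ∑ i, Q.zeta w i • Q.a i + w.uX = 0 := by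
  have h1 : ∑ i, Q.zeta w i • Q.a i = ∑ i, ‖Q.a i‖ • w.u i := by
    refine Finset.sum_congr rfl (fun i _ => ?_)
    conv_rhs => rw [Q.u_eq_of_supportFn_ne_top w (ha i) ((Q.finite_of_D_ne_bot ha h).1 i)]
    rw [abar, smul_smul, smul_smul]
    congr 1
    have := (ha i).ne'
    field_simp
  rw [h1]; exact hw.1

/-- As `abar^i` is a unit vector, the scaled residual is 1-Lipschitz in `d`. It vanishes or has the
admissible sign on `C_i`, so the violation is at most `‖a^i‖` times the distance to `C_i`, and the
factors `1 ± z` are at least `β`. -/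
theorem viol_le_norm_mul_infDist {i : Fin m} (ha : 0 < ‖Q.a i‖) {d : Vec n} {z β : ℝ}
    (hβ : 0 ≤ β) (hz : |z| ≤ 1 - β) :
    β * viol ((i : ℕ) < Q.mbar) (Q.b i + inner ℝ (Q.a i) d) ≤
      if 0 < inner ℝ (Q.abar i) d + Q.bbar i then
        (1 - z) * ‖Q.a i‖ * Metric.infDist d (Q.C i)
      else if (i : ℕ) < Q.mbar ∧ inner ℝ (Q.abar i) d + Q.bbar i < 0 then
        (1 + z) * ‖Q.a i‖ * Metric.infDist d (Q.C i)
      else 0 := by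
  have hne := Q.C_nonempty ha
  obtain ⟨hz1, hz2⟩ := abs_le.1 hz
  set t := inner ℝ (Q.abar i) d + Q.bbar i with ht
  have key : ∀ y : Vec n, |t - (inner ℝ (Q.abar i) y + Q.bbar i)| ≤ dist d y := by
    intro y
    have h1 : t - (inner ℝ (Q.abar i) y + Q.bbar i) = inner ℝ (Q.abar i) (d - y) := by
      rw [ht, inner_sub_right]; ring
    rw [h1, dist_eq_norm]
    refine (abs_real_inner_le_norm _ _).trans ?_
    rw [Q.norm_abar ha, one_mul]
  have fin : ∀ (ζ D s : ℝ), β ≤ ζ → 0 ≤ ζ → s ≤ D → 0 ≤ s → β * (‖Q.a i‖ * s) ≤ ζ * ‖Q.a i‖ * D := by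
    intro ζ D s h1 h2 h3 h4
    have h5 : β * (‖Q.a i‖ * s) ≤ ζ * (‖Q.a i‖ * s) :=
      mul_le_mul_of_nonneg_right h1 (by positivity)
    have h6 : ζ * (‖Q.a i‖ * s) ≤ ζ * (‖Q.a i‖ * D) := by gcongr
    linarith
  rw [← Q.norm_mul_residual ha d, ← ht]
  have hviol : ∀ s : ℝ, viol ((i : ℕ) < Q.mbar) (‖Q.a i‖ * s) =
      ‖Q.a i‖ * viol ((i : ℕ) < Q.mbar) s := by
    intro s
    unfold viol; split_ifs
    · rw [abs_mul, abs_norm]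
    · rw [mul_max_of_nonneg _ _ ha.le, mul_zero]
  rw [hviol]
  split_ifs with hpos hneg
  · have hv : viol ((i : ℕ) < Q.mbar) t = t := by
      unfold viol; split_ifs
      · exact abs_of_pos hpos
      · exact max_eq_left hpos.le
    rw [hv]
    refine fin _ _ _ (by linarith) (by linarith) ?_ hpos.le
    refine (Metric.le_infDist hne).2 (fun y hy => ?_)
    have h1 := (le_abs_self _).trans (key y)
    have h2 : inner ℝ (Q.abar i) y + Q.bbar i ≤ 0 := by
      unfold C at hy; split_ifs at hy
      · exact (show _ = _ from hy).le
      · exact hy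
    linarith
  · have hv : viol ((i : ℕ) < Q.mbar) t = -t := by
      unfold viol; rw [if_pos hneg.1]; exact abs_of_neg hneg.2
    rw [hv]
    refine fin _ _ _ (by linarith) (by linarith) ?_ (by linarith)
    refine (Metric.le_infDist hne).2 (fun y hy => ?_)
    have h1 := (neg_le_abs _).trans (key y)
    have h2 : inner ℝ (Q.abar i) y + Q.bbar i = 0 := by
      unfold C at hy; rw [if_pos hneg.1] at hy; exact hy
    linarith
  · have hv : viol ((i : ℕ) < Q.mbar) t = 0 := by
      push Not at hpos
      unfold viol; split_ifs with he
      · have : t = 0 := le_antisymm hpos (by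
          by_contra hlt; exact hneg ⟨he, not_le.1 hlt⟩)
        rw [this, abs_zero]
      · exact max_eq_right hpos
    rw [hv]; simp

/-- If all multipliers are small, the complementarity measure controls the linearized
infeasibility. -/
theorem mul_l_le_chi (ha : ∀ i, 0 < ‖Q.a i‖) {w : DualVar n m} {d : Vec n} {β : ℝ}
    (hβ : 0 ≤ β) (hz : ∀ i, |Q.zeta w i| ≤ 1 - β) : β * Q.l d 0 ≤ Q.chi d w := by
  rw [l_eq, zero_mul, zero_add, Finset.mul_sum]
  exact Finset.sum_le_sum fun i _ => Q.viol_le_norm_mul_infDist (ha i) hβ (hz i)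

end QP

/-! ### Gradients -/

theorem continuous_gradient {h : Vec n → ℝ} (hh : ContDiff ℝ 1 h) : Continuous (gradient h) :=
  (InnerProductSpace.toDual ℝ (Vec n)).symm.continuous.comp (hh.continuous_fderiv one_ne_zero)

theorem norm_gradient_sub_le {h : Vec n → ℝ} {U : Set (Vec n)} (hU : Convex ℝ U) {M : ℝ}
    (hd : ∀ y ∈ U, DifferentiableAt ℝ (gradient h) y)
    (hM : ∀ y ∈ U, ‖fderiv ℝ (gradient h) y‖ ≤ M) {x y : Vec n} (hx : x ∈ U) (hy : y ∈ U) :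
    ‖gradient h y - gradient h x‖ ≤ M * ‖y - x‖ :=
  hU.norm_image_sub_le_of_norm_fderiv_le hd hM hx hy

/-- The first-order Taylor estimate for a function with bounded second derivative. -/
theorem abs_taylor_le {h : Vec n → ℝ} (hh : Differentiable ℝ h) {U : Set (Vec n)}
    (hU : Convex ℝ U) {M : ℝ} (hd : ∀ y ∈ U, DifferentiableAt ℝ (gradient h) y)
    (hM : ∀ y ∈ U, ‖fderiv ℝ (gradient h) y‖ ≤ M) {x d : Vec n} (hx : x ∈ U) (hxd : x + d ∈ U)
    {a : ℝ} (h0 : 0 ≤ a) (h1 : a ≤ 1) :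
    |h (x + a • d) - (h x + a * inner ℝ (gradient h x) d)| ≤ M * a ^ 2 * ‖d‖ ^ 2 := by
  have hM0 : 0 ≤ M := (norm_nonneg _).trans (hM x hx)
  have hxa : x + a • d ∈ U := hU.add_smul_mem hx hxd ⟨h0, h1⟩
  have hseg : segment ℝ x (x + a • d) ⊆ U := hU.segment_subset hx hxa
  -- After subtracting the linear part, the derivative is at most `M a ‖d‖` on the segment, so the
  -- mean value inequality suffices; it yields the constant `M` instead of `M / 2`.
  let L : Vec n →L[ℝ] ℝ := InnerProductSpace.toDual ℝ (Vec n) (gradient h x)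
  have hder : ∀ y ∈ segment ℝ x (x + a • d), HasFDerivWithinAt (fun y => h y - L y)
      (InnerProductSpace.toDual ℝ (Vec n) (gradient h y) - L) (segment ℝ x (x + a • d)) y :=
    fun y _ => ((hh y).hasGradientAt.hasFDerivAt.sub L.hasFDerivAt).hasFDerivWithinAt
  have hbound : ∀ y ∈ segment ℝ x (x + a • d),
      ‖InnerProductSpace.toDual ℝ (Vec n) (gradient h y) - L‖ ≤ M * (a * ‖d‖) := by
    intro y hy
    rw [← map_sub, LinearIsometryEquiv.norm_map]
    refine (norm_gradient_sub_le hU hd hM hx (hseg hy)).trans ?_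
    have h2 : ‖y - x‖ ≤ a * ‖d‖ := by
      have := norm_sub_le_of_mem_segment hy
      simpa [norm_smul, abs_of_nonneg h0] using this
    gcongr
  have key := (convex_segment x (x + a • d)).norm_image_sub_le_of_norm_hasFDerivWithin_le hder
    hbound (left_mem_segment ℝ _ _) (right_mem_segment ℝ _ _)
  have e1 : h (x + a • d) - L (x + a • d) - (h x - L x) =
      h (x + a • d) - (h x + a * inner ℝ (gradient h x) d) := by
    have : L d = inner ℝ (gradient h x) d := InnerProductSpace.toDual_apply_apply
    rw [map_add, map_smul, this, smul_eq_mul]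
    ring
  rw [e1, Real.norm_eq_abs] at key
  refine key.trans_eq ?_
  rw [add_sub_cancel_left, norm_smul, Real.norm_eq_abs, abs_of_nonneg h0]
  ring

namespace NLP

variable (P : NLP n m)

theorem v_eq (x : Vec n) : P.v x = ∑ i, viol (P.IsEq i) (P.c i x) := rfl

theorem v_nonneg (x : Vec n) : 0 ≤ P.v x := Finset.sum_nonneg fun _ _ => viol_nonneg _ _

theorem continuous_v : Continuous P.v :=
  continuous_finsetSum _ fun i _ => (continuous_viol (P.IsEq i)).comp (P.c_smooth i).continuous

theorem viol_eq_zero_iff (i : Fin m) (t : ℝ) :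
    viol (P.IsEq i) t = 0 ↔ (P.IsEq i → t = 0) ∧ (¬ P.IsEq i → t ≤ 0) := by
  unfold viol; split_ifs with h <;> simp [h]

theorem feasible_iff (x : Vec n) : P.Feasible x ↔ P.v x = 0 := by
  rw [v_eq, Finset.sum_eq_zero_iff_of_nonneg fun _ _ => viol_nonneg _ _]
  simp only [viol_eq_zero_iff, Feasible, Finset.mem_univ, true_imp_iff]
  exact forall_and.symm

theorem gradient_fritzJohn (x : Vec n) (ρ : ℝ) (η : Vec m) :
    gradient (fun y => P.fritzJohn y ρ η) x =
      ρ • gradient P.f x + ∑ i, η i • gradient (P.c i) x := by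
  have hf := ((P.f_smooth.differentiable one_ne_zero) x).hasGradientAt
  have hc := fun i => (((P.c_smooth i).differentiable one_ne_zero) x).hasGradientAt
  refine HasGradientAt.gradient ?_
  rw [hasGradientAt_iff_hasFDerivAt, map_add, map_smul, map_sum]
  simp only [map_smul]
  unfold fritzJohn
  exact (hf.hasFDerivAt.const_mul ρ).add
    (HasFDerivAt.fun_sum fun i _ => (hc i).hasFDerivAt.const_mul (η i))

/-- Multipliers at `x` that are subgradients of the violations in the weak form produced by a
limit of dual variables. -/
structure IsMultiplier (x : Vec n) (ρ : ℝ) (ζ : Fin m → ℝ) : Prop where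
  abs_le_one : ∀ i, |ζ i| ≤ 1
  nonneg : ∀ i, ¬ P.IsEq i → 0 ≤ ζ i
  grad : ρ • gradient P.f x + ∑ i, ζ i • gradient (P.c i) x = 0
  v_le : P.v x ≤ ∑ i, ζ i * P.c i x

-- Each product is at most its violation, while the total is at least the sum of the violations;
-- hence equality holds termwise.
variable {P} in
theorem IsMultiplier.mul_eq_viol {x : Vec n} {ρ : ℝ} {ζ : Fin m → ℝ} (h : P.IsMultiplier x ρ ζ)
    (i : Fin m) : ζ i * P.c i x = viol (P.IsEq i) (P.c i x) := by
  have hle : ∀ i ∈ Finset.univ, ζ i * P.c i x ≤ viol (P.IsEq i) (P.c i x) :=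
    fun i _ => mul_le_viol _ (h.abs_le_one i) (h.nonneg i) _
  exact (Finset.sum_eq_sum_iff_of_le hle).1 (le_antisymm (Finset.sum_le_sum hle) h.v_le) i
    (Finset.mem_univ i)

variable {P} in
theorem IsMultiplier.isStationaryForV {x : Vec n} {ζ : Fin m → ℝ} (h : P.IsMultiplier x 0 ζ) :
    P.IsStationaryForV x := by
  refine ⟨WithLp.toLp 2 ζ, ?_, fun i hi => ?_, fun i hi => ?_⟩
  · rw [gradient_fritzJohn]; exact h.grad
  · have h1 := h.mul_eq_viol i
    rw [viol, if_pos hi] at h1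
    refine ⟨(abs_le.1 (h.abs_le_one i)).1, (abs_le.1 (h.abs_le_one i)).2, fun hc => ?_,
      fun hc => ?_⟩
    · rw [abs_of_pos hc] at h1
      exact mul_right_cancel₀ hc.ne' (by rw [one_mul]; exact h1)
    · rw [abs_of_neg hc] at h1
      exact mul_right_cancel₀ hc.ne (by rw [neg_one_mul]; exact h1)
  · have h1 := h.mul_eq_viol i
    rw [viol, if_neg hi] at h1
    refine ⟨h.nonneg i hi, (abs_le.1 (h.abs_le_one i)).2, fun hc => ?_, fun hc => ?_⟩
    · rw [max_eq_left hc.le] at h1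
      exact mul_right_cancel₀ hc.ne' (by rw [one_mul]; exact h1)
    · rw [max_eq_right hc.le] at h1
      exact (mul_eq_zero.1 h1).resolve_right hc.ne

variable {P} in
theorem IsMultiplier.isKKT {x : Vec n} {ρ : ℝ} (hρ : 0 < ρ) {ζ : Fin m → ℝ}
    (h : P.IsMultiplier x ρ ζ) (hx : P.Feasible x) : P.IsKKT x := by
  refine ⟨hx, WithLp.toLp 2 (fun i => ρ⁻¹ * ζ i), ?_, fun i hi => ⟨?_, ?_⟩⟩
  · rw [gradient_fritzJohn]
    have h1 : ρ⁻¹ • (ρ • gradient P.f x + ∑ i, ζ i • gradient (P.c i) x) = 0 := by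
      rw [h.grad, smul_zero]
    rw [smul_add, smul_smul, inv_mul_cancel₀ hρ.ne', Finset.smul_sum] at h1
    simpa only [smul_smul] using h1
  · exact mul_nonneg (inv_nonneg.2 hρ.le) (h.nonneg i hi)
  · have h1 := h.mul_eq_viol i
    rw [(P.viol_eq_zero_iff i _).2 ⟨hx.1 i, hx.2 i⟩] at h1
    show ρ⁻¹ * ζ i * _ = 0
    rw [mul_assoc, h1, mul_zero]

variable {P} in
/-- The Mangasarian-Fromovitz constraint qualification excludes nonzero singular multipliers. -/
theorem IsMultiplier.eq_zero_of_mfcq {x : Vec n} {ζ : Fin m → ℝ} (h : P.IsMultiplier x 0 ζ)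
    (hx : P.MFCQ x) (i : Fin m) : ζ i = 0 := by
  obtain ⟨hv, hli, d, hd1, hd2⟩ := hx
  have hg : ∑ i, ζ i • gradient (P.c i) x = 0 := by simpa using h.grad
  -- The gradient equation removes the linear part, so this sum is at least `v ≥ 0`. Every term is
  -- nonpositive by the choice of `d`, hence all vanish: strict inequality kills the multipliers of
  -- the inequalities, linear independence those of the equalities.
  have hsum : ∑ i, ζ i * (P.c i x + inner ℝ (gradient (P.c i) x) d) = ∑ i, ζ i * P.c i x := by
    have h1 : inner ℝ (∑ i, ζ i • gradient (P.c i) x) d = (0 : ℝ) := by rw [hg, inner_zero_left]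
    rw [sum_inner] at h1
    simp only [inner_smul_left, conj_trivial] at h1
    simp only [mul_add]
    rw [Finset.sum_add_distrib, h1, add_zero]
  have hterm : ∀ i ∈ Finset.univ, ζ i * (P.c i x + inner ℝ (gradient (P.c i) x) d) ≤ 0 := by
    intro i _
    by_cases hi : P.IsEq i
    · rw [hd1 i hi, mul_zero]
    · exact mul_nonpos_of_nonneg_of_nonpos (h.nonneg i hi) (hd2 i hi).le
  have hzero : ∑ i, ζ i * (P.c i x + inner ℝ (gradient (P.c i) x) d) = 0 := by
    refine le_antisymm (Finset.sum_nonpos hterm) ?_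
    rw [hsum]; exact (P.v_nonneg x).trans h.v_le
  rw [Finset.sum_eq_zero_iff_of_nonpos hterm] at hzero
  have hineq : ∀ i, ¬ P.IsEq i → ζ i = 0 := fun i hi =>
    (mul_eq_zero.1 (hzero i (Finset.mem_univ i))).resolve_right (hd2 i hi).ne
  by_cases hi : P.IsEq i
  · have h2 : ∑ j : {i : Fin m // P.IsEq i}, ζ j • gradient (P.c j) x = 0 := by
      rw [← hg, ← Finset.sum_subtype (Finset.univ.filter P.IsEq) (by simp)
        (fun i => ζ i • gradient (P.c i) x)]
      refine Finset.sum_filter_of_ne fun j _ hj => ?_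
      by_contra hne
      exact hj (by rw [hineq j hne, zero_smul])
    exact Fintype.linearIndependent_iff.1 hli (fun j => ζ j) h2 ⟨i, hi⟩
  · exact hineq i hi

/-- Limits of approximate multipliers are multipliers. -/
theorem exists_tendsto_isMultiplier {x : ℕ → Vec n} {z : Vec n} (hx : Tendsto x atTop (𝓝 z))
    {ρ : ℕ → ℝ} {r : ℝ} (hρ : Tendsto ρ atTop (𝓝 r)) {p q : ℕ → Vec n} {ζ : ℕ → Fin m → ℝ}
    {ε : ℕ → ℝ} (hε : Tendsto ε atTop (𝓝 0)) {κ τ : ℝ} (hκ : 0 < κ) (hτ : 0 < τ)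
    (habs : ∀ j i, |ζ j i| ≤ 1) (hnn : ∀ j i, ¬ P.IsEq i → 0 ≤ ζ j i)
    (heq : ∀ j, p j + ρ j • gradient P.f (x j) + ∑ i, ζ j i • gradient (P.c i) (x j) + q j = 0)
    (hle : ∀ j, P.v (x j) + κ * ‖p j‖ ^ 2 + τ * ‖q j‖ ≤ ∑ i, ζ j i * P.c i (x j) + ε j) :
    ∃ ζ' : Fin m → ℝ, P.IsMultiplier z r ζ' ∧
      ∃ φ : ℕ → ℕ, StrictMono φ ∧ Tendsto (fun j => ζ (φ j)) atTop (𝓝 ζ') := by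
  -- Together with `hle` this leaves `κ‖p j‖² + τ‖q j‖ ≤ ε j`, so both perturbations vanish in the
  -- limit.
  have hsum : ∀ j, ∑ i, ζ j i * P.c i (x j) ≤ P.v (x j) := fun j =>
    Finset.sum_le_sum fun i _ => mul_le_viol _ (habs j i) (hnn j i) _
  have hp : Tendsto p atTop (𝓝 0) := by
    rw [tendsto_zero_iff_norm_tendsto_zero]
    have h1 : Tendsto (fun j => Real.sqrt (κ⁻¹ * ε j)) atTop (𝓝 0) := by
      simpa using (hε.const_mul κ⁻¹).sqrt
    refine squeeze_zero (fun _ => norm_nonneg _) (fun j => Real.le_sqrt_of_sq_le ?_) h1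
    rw [← div_eq_inv_mul, le_div_iff₀' hκ]
    have := hle j
    have := hsum j
    have : 0 ≤ τ * ‖q j‖ := by positivity
    linarith
  have hq : Tendsto q atTop (𝓝 0) := by
    rw [tendsto_zero_iff_norm_tendsto_zero]
    have h1 : Tendsto (fun j => τ⁻¹ * ε j) atTop (𝓝 0) := by simpa using hε.const_mul τ⁻¹
    refine squeeze_zero (fun _ => norm_nonneg _) (fun j => ?_) h1
    rw [← div_eq_inv_mul, le_div_iff₀' hτ]
    have := hle j
    have := hsum j
    have : 0 ≤ κ * ‖p j‖ ^ 2 := by positivity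
    linarith
  have hcomp : IsCompact (Set.pi univ fun _ : Fin m => Icc (-1 : ℝ) 1) :=
    isCompact_univ_pi fun _ => isCompact_Icc
  obtain ⟨ζ', -, φ, hφ, hlim⟩ := hcomp.tendsto_subseq (x := ζ)
    (fun j i _ => abs_le.1 (habs j i))
  have hlimi : ∀ i, Tendsto (fun j => ζ (φ j) i) atTop (𝓝 (ζ' i)) := fun i =>
    (tendsto_pi_nhds.1 hlim) i
  have hφt := hφ.tendsto_atTop
  have hxφ := hx.comp hφt
  have hf := ((continuous_gradient P.f_smooth).tendsto z).comp hxφ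
  have hc := fun i => ((continuous_gradient (P.c_smooth i)).tendsto z).comp hxφ
  have hc0 := fun i => ((P.c_smooth i).continuous.tendsto z).comp hxφ
  have hv := (P.continuous_v.tendsto z).comp hxφ
  refine ⟨ζ', ⟨fun i => ?_, fun i hi => ?_, ?_, ?_⟩, φ, hφ, hlim⟩
  · exact le_of_tendsto' (hlimi i).abs fun j => habs _ i
  · exact ge_of_tendsto' (hlimi i) fun j => hnn _ i hi
  · have h1 := (((hp.comp hφt).add ((hρ.comp hφt).smul hf)).add
      (tendsto_finsetSum Finset.univ fun i _ => (hlimi i).smul (hc i))).add (hq.comp hφt)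
    rw [zero_add, add_zero] at h1
    refine tendsto_nhds_unique h1 ?_
    exact tendsto_const_nhds.congr fun j => (heq (φ j)).symm
  · have h1 := (tendsto_finsetSum Finset.univ fun i _ => (hlimi i).mul (hc0 i)).add
      (hε.comp hφt)
    rw [add_zero] at h1
    refine le_of_tendsto_of_tendsto' hv h1 fun j => ?_
    refine le_trans ?_ (hle (φ j))
    have h2 : 0 ≤ κ * ‖p (φ j)‖ ^ 2 := by positivity
    have h3 : 0 ≤ τ * ‖q (φ j)‖ := by positivity
    show P.v (x (φ j)) ≤ _
    linarith

end NLP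

/-! ### Elementary properties of the models -/

namespace QP

variable (Q : QP n m)

theorem deltaL_eq (d : Vec n) (ρ : ℝ) :
    Q.deltaL d ρ = Q.deltaL d 0 - ρ * inner ℝ Q.g d := by
  simp only [deltaL, l_eq, inner_zero_right]
  ring

theorem l_zero_nonneg (d : Vec n) : 0 ≤ Q.l d 0 := by
  rw [l_eq, zero_mul, zero_add]
  exact Finset.sum_nonneg fun _ _ => viol_nonneg _ _

theorem l_zero_add_mul (d : Vec n) (ρ : ℝ) : Q.l d ρ = Q.l d 0 + ρ * inner ℝ Q.g d := by
  simp only [l_eq]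
  ring

theorem J_toReal {d : Vec n} (hd : d ∈ Q.X) (ρ : ℝ) :
    (Q.J d ρ).toReal = Q.l d ρ + 1 / 2 * quad (Q.H ρ) d := by
  unfold J; rw [if_pos hd, add_zero, EReal.toReal_coe]

theorem deltaL_le {M : ℝ} (hg : ‖Q.g‖ ≤ M) (ha : ∀ i, ‖Q.a i‖ ≤ M) (d : Vec n) {ρ : ℝ}
    (hρ : 0 ≤ ρ) : Q.deltaL d ρ ≤ (ρ + m) * M * ‖d‖ := by
  have h1 : -(ρ * inner ℝ Q.g d) ≤ ρ * (M * ‖d‖) := by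
    rw [← mul_neg]
    refine mul_le_mul_of_nonneg_left ((neg_le_abs _).trans ?_) hρ
    exact (abs_real_inner_le_norm _ _).trans (by gcongr)
  have h2 : ∑ i : Fin m, viol ((i : ℕ) < Q.mbar) (Q.b i + inner ℝ (Q.a i) 0) ≤
      ∑ i : Fin m, (viol ((i : ℕ) < Q.mbar) (Q.b i + inner ℝ (Q.a i) d) + M * ‖d‖) := by
    refine Finset.sum_le_sum fun i _ => (viol_le_add_abs_sub _ _ (Q.b i + inner ℝ (Q.a i) d)).trans ?_
    gcongr
    rw [inner_zero_right, add_zero, sub_add_cancel_left, abs_neg]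
    exact (abs_real_inner_le_norm _ _).trans (by gcongr; exact ha i)
  rw [Finset.sum_add_distrib, Finset.sum_const, Finset.card_univ, Fintype.card_fin,
    nsmul_eq_mul] at h2
  simp only [deltaL, l_eq]
  rw [inner_zero_right (𝕜 := ℝ) Q.g]
  linarith

end QP

/-- A bounded function with bounded first and second derivatives on `U`, with one bound `M`. -/
structure BoundedBy (h : Vec n → ℝ) (U : Set (Vec n)) (M : ℝ) : Prop where
  diff : ∀ y ∈ U, DifferentiableAt ℝ (gradient h) y
  abs_le : ∀ y ∈ U, |h y| ≤ M
  norm_gradient_le : ∀ y ∈ U, ‖gradient h y‖ ≤ M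
  norm_fderiv_le : ∀ y ∈ U, ‖fderiv ℝ (gradient h) y‖ ≤ M

theorem BoundedBy.mono {h : Vec n → ℝ} {U : Set (Vec n)} {M M' : ℝ} (hb : BoundedBy h U M)
    (hM : M ≤ M') : BoundedBy h U M' :=
  ⟨hb.diff, fun y hy => (hb.abs_le y hy).trans hM, fun y hy => (hb.norm_gradient_le y hy).trans hM,
    fun y hy => (hb.norm_fderiv_le y hy).trans hM⟩

namespace Trajectory

theorem BoundedDerivs.exists_boundedBy {h : Vec n → ℝ} {U : Set (Vec n)}
    (hb : BoundedDerivs h U) : ∃ M, BoundedBy h U M := by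
  obtain ⟨hd, M, hM⟩ := hb
  exact ⟨M, hd, fun y hy => (hM y hy).1, fun y hy => (hM y hy).2.1, fun y hy => (hM y hy).2.2⟩

variable {T : Trajectory n m} {P : NLP n m} {X : Set (Vec n)} {p : Params}

theorem GlobalAssumption.exists_bound (hglobal : T.GlobalAssumption P X) :
    ∃ (U : Set (Vec n)) (M : ℝ), Convex ℝ U ∧ 0 ≤ M ∧ (∀ k, T.x k ∈ U ∧ T.x k + T.d k ∈ U) ∧
      BoundedBy P.f U M ∧ ∀ i, BoundedBy (P.c i) U M := by
  obtain ⟨U, -, hU, hmem, hf, hc⟩ := hglobal.bounded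
  obtain ⟨Mf, hMf⟩ := hf.exists_boundedBy
  choose Mc hMc using fun i => (hc i).exists_boundedBy
  have hs : ∀ i, |Mc i| ≤ ∑ i, |Mc i| := fun i =>
    Finset.single_le_sum (f := fun i => |Mc i|) (fun _ _ => abs_nonneg _) (Finset.mem_univ i)
  have hs0 : 0 ≤ ∑ i, |Mc i| := Finset.sum_nonneg fun _ _ => abs_nonneg _
  refine ⟨U, |Mf| + ∑ i, |Mc i|, hU, by positivity, hmem, hMf.mono ?_, fun i => (hMc i).mono ?_⟩
  · linarith [le_abs_self Mf]
  · linarith [le_abs_self (Mc i), hs i, abs_nonneg Mf]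

theorem qp_l_zero (k : ℕ) (ρ : ℝ) : (T.qp P X k).l 0 ρ = P.v (T.x k) := by
  simp only [QP.l_eq, inner_zero_right, mul_zero, add_zero, zero_add]
  rfl

theorem qp_Jzero (k : ℕ) : (T.qp P X k).Jzero = P.v (T.x k) := qp_l_zero k 0

theorem deltaL_zero_eq (k : ℕ) (d : Vec n) (ρ : ℝ) :
    (T.qp P X k).deltaL d ρ = P.v (T.x k) - (T.qp P X k).l d ρ := by
  rw [QP.deltaL, qp_l_zero]

/-! ### Bounds on the dual objective -/

theorem GlobalAssumption.norm_a_pos (hglobal : T.GlobalAssumption P X) (k : ℕ) (i : Fin m) :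
    0 < ‖(T.qp P X k).a i‖ :=
  hglobal.grad_pos k i

theorem sum_zeta_mul_le_v (hglobal : T.GlobalAssumption P X) {k : ℕ} {w : DualVar n m} {ρ : ℝ}
    (hw : (T.qp P X k).DualFeasible w) (h : (T.qp P X k).D w ρ ≠ ⊥) :
    ∑ i, (T.qp P X k).zeta w i * P.c i (T.x k) ≤ P.v (T.x k) := by
  refine Finset.sum_le_sum fun i _ => mul_le_viol _ ?_ ?_ _
  · exact (T.qp P X k).abs_zeta_le_one w (hglobal.norm_a_pos k i) (hw.2 i)
  · exact (T.qp P X k).zeta_nonneg_of_supportFn_ne_top w (hglobal.norm_a_pos k i)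
      (((T.qp P X k).finite_of_D_ne_bot (hglobal.norm_a_pos k) h).1 i)

theorem GlobalAssumption.exists_closedBall_subset (hglobal : T.GlobalAssumption P X) :
    ∃ τ > 0, Metric.closedBall (0 : Vec n) τ ⊆ X :=
  Metric.nhds_basis_closedBall.mem_iff.1 (mem_interior_iff_mem_nhds.1 hglobal.zero_mem)

theorem D_toReal_le_sum (hglobal : T.GlobalAssumption P X) (hqp : T.SubproblemAssumption P X p)
    {k : ℕ} {w : DualVar n m} {ρ : ℝ} (hρ : ρ ∈ Icc 0 (T.ρprev p k))
    (h : (T.qp P X k).D w ρ ≠ ⊥) :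
    ((T.qp P X k).D w ρ).toReal ≤ ∑ i, (T.qp P X k).zeta w i * P.c i (T.x k) := by
  obtain ⟨τ, hτ, hX⟩ := hglobal.exists_closedBall_subset
  have h1 := (T.qp P X k).D_toReal_le (hglobal.norm_a_pos k) h hτ.le hX
  have h2 := quad_nonneg (hqp.posDef k ρ hρ).inv (w.u0 - ρ • (T.qp P X k).g)
  have h3 : 0 ≤ τ * ‖w.uX‖ := by positivity
  have h4 : ∑ i, (T.qp P X k).zeta w i * (T.qp P X k).b i =
    ∑ i, (T.qp P X k).zeta w i * P.c i (T.x k) := rfl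
  linarith

theorem D_toReal_le_v (hglobal : T.GlobalAssumption P X) (hqp : T.SubproblemAssumption P X p)
    {k : ℕ} {w : DualVar n m} {ρ : ℝ} (hρ : ρ ∈ Icc 0 (T.ρprev p k))
    (hw : (T.qp P X k).DualFeasible w) (h : (T.qp P X k).D w ρ ≠ ⊥) :
    ((T.qp P X k).D w ρ).toReal ≤ P.v (T.x k) :=
  (D_toReal_le_sum hglobal hqp hρ h).trans (sum_zeta_mul_le_v hglobal hw h)

theorem D_uIn_ne_bot (hglobal : T.GlobalAssumption P X) (hsolver : T.SolverAssumption P X)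
    {k j : ℕ} (hj : j ≤ T.jEnd k) (ρ : ℝ) : (T.qp P X k).D (T.uIn k j) ρ ≠ ⊥ :=
  (T.qp P X k).D_ne_bot_of_D_ne_bot (hglobal.norm_a_pos k) (ρ := 0)
    ((hsolver.dual_start k).trans_le (hsolver.dual_no_worse k j hj).2).ne' ρ

theorem D_wIn_ne_bot (hglobal : T.GlobalAssumption P X) (hsolver : T.SolverAssumption P X)
    {k j : ℕ} (hj : j ≤ T.jEnd k) (ρ : ℝ) : (T.qp P X k).D (T.wIn k j) ρ ≠ ⊥ :=
  (T.qp P X k).D_ne_bot_of_D_ne_bot (hglobal.norm_a_pos k) (ρ := 0)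
    ((bot_lt_iff_ne_bot.2 (D_uIn_ne_bot hglobal hsolver hj 0)).trans_le
      (hsolver.dual_no_worse k j hj).1).ne' ρ

/-! ### The penalty parameters -/

theorem IsRun.omega_pos (hrun : T.IsRun P X p) (k : ℕ) : 0 < T.ω k := by
  cases k with
  | zero => rw [hrun.omega_zero]; exact p.ωinit_pos
  | succ k => exact (hrun.omega_succ k).1

theorem IsRun.tendsto_omega (hrun : T.IsRun P X p) : Tendsto T.ω atTop (𝓝 0) := by
  have h : ∀ k, T.ω k ≤ p.ωinit * p.θω ^ k := by
    intro k
    induction k with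
    | zero => rw [hrun.omega_zero, pow_zero, mul_one]
    | succ k ih =>
      refine (hrun.omega_succ k).2.trans ?_
      rw [pow_succ', ← mul_assoc, mul_comm p.ωinit, mul_assoc]
      exact mul_le_mul_of_nonneg_left ih p.θω_mem.1.le
  refine squeeze_zero (fun k => (hrun.omega_pos k).le) h ?_
  simpa using (tendsto_pow_atTop_nhds_zero_of_lt_one p.θω_mem.1.le p.θω_mem.2).const_mul p.ωinit

theorem IsRun.ρIn_mem (hrun : T.IsRun P X p) {k : ℕ} (hk : 0 < T.ρprev p k) (j : ℕ)
    (hj : j ≤ T.jEnd k) : T.ρIn k j ∈ Ioc 0 (T.ρprev p k) := by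
  induction j with
  | zero => rw [hrun.inner_start]; exact ⟨hk, le_rfl⟩
  | succ j ih =>
    have ih := ih (Nat.le_of_succ_le hj)
    by_cases h : T.Rphi P X p k j ∧ T.Rc P X p k j
    · rw [hrun.dust_update k j hj h.1 h.2 fun hv => hrun.inner_continue k j hj ⟨h.1, h.2, hv⟩]
      exact ⟨mul_pos p.θρ_mem.1 ih.1,
        (mul_le_of_le_one_left ih.1.le p.θρ_mem.2.le).trans ih.2⟩
    · rw [hrun.dust_keep k j hj h]; exact ih

/-- Condition (Rv) without fractions. -/
theorem Rv_iff (hrun : T.IsRun P X p) (hglobal : T.GlobalAssumption P X)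
    (hqp : T.SubproblemAssumption P X p) (hsolver : T.SolverAssumption P X) {k j : ℕ}
    (hk : 0 < T.ρprev p k) (hj : j ≤ T.jEnd k) :
    T.Rv P X p k j ↔
      p.βv * (P.v (T.x k) + T.ω k - max ((T.qp P X k).D (T.wIn k j) 0).toReal 0) ≤
        P.v (T.x k) + T.ω k - (T.qp P X k).l (T.dIn k j) 0 := by
  -- Weak duality makes the denominator at least `ω_k > 0`.
  have h1 := D_toReal_le_v hglobal hqp (left_mem_Icc.2 hk.le) (hsolver.dual_feasible k j hj).2
    (D_wIn_ne_bot hglobal hsolver hj 0)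
  have h2 := max_le h1 (P.v_nonneg (T.x k))
  have h3 := hrun.omega_pos k
  rw [Rv, QP.rv, qp_Jzero, le_div_iff₀ (by linarith)]

/-- Condition (Rphi) without fractions. -/
theorem Rphi_iff (hrun : T.IsRun P X p) (hglobal : T.GlobalAssumption P X)
    (hqp : T.SubproblemAssumption P X p) (hsolver : T.SolverAssumption P X) {k j : ℕ}
    (hk : 0 < T.ρprev p k) (hj : j ≤ T.jEnd k) :
    T.Rphi P X p k j ↔
      p.βφ * (P.v (T.x k) + T.ω k - ((T.qp P X k).D (T.uIn k j) (T.ρIn k j)).toReal) ≤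
        P.v (T.x k) + T.ω k - ((T.qp P X k).l (T.dIn k j) (T.ρIn k j) +
          1 / 2 * quad ((T.qp P X k).H (T.ρIn k j)) (T.dIn k j)) := by
  have h1 := D_toReal_le_v hglobal hqp (Ioc_subset_Icc_self (hrun.ρIn_mem hk j hj))
    (hsolver.dual_feasible k j hj).1 (D_uIn_ne_bot hglobal hsolver hj _)
  have h3 := hrun.omega_pos k
  rw [Rphi, QP.rphi, qp_Jzero, QP.J_toReal _ (hsolver.primal_mem k j hj),
    le_div_iff₀ (by linarith)]

theorem half_quad_le_deltaL (hsolver : T.SolverAssumption P X) (hglobal : T.GlobalAssumption P X)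
    {k j : ℕ} (hj : j ≤ T.jEnd k) :
    1 / 2 * quad ((T.qp P X k).H (T.ρIn k j)) (T.dIn k j) ≤
      (T.qp P X k).deltaL (T.dIn k j) (T.ρIn k j) := by
  have h1 := hsolver.primal_no_worse k j hj
  have h0 : (0 : Vec n) ∈ (T.qp P X k).X := interior_subset hglobal.zero_mem
  have hd : T.dIn k j ∈ (T.qp P X k).X := hsolver.primal_mem k j hj
  unfold QP.J at h1
  rw [if_pos h0, if_pos hd, add_zero, add_zero, EReal.coe_le_coe_iff, qp_l_zero] at h1
  have h2 : quad ((T.qp P X k).H (T.ρIn k j)) 0 = 0 := by simp [quad]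
  rw [h2] at h1
  rw [deltaL_zero_eq]
  linarith

/-- Condition (Rv) at termination bounds this quantity below by `β_v` times a denominator that is at
least `ω_k`. It supplies the positive numerator in the PSST formula. -/
theorem deltaL_add_omega_pos (hrun : T.IsRun P X p) (hglobal : T.GlobalAssumption P X)
    (hqp : T.SubproblemAssumption P X p) (hsolver : T.SolverAssumption P X) {k : ℕ}
    (hk : 0 < T.ρprev p k) : 0 < (T.qp P X k).deltaL (T.d k) 0 + T.ω k := by
  have h1 := (Rv_iff hrun hglobal hqp hsolver hk le_rfl).1 (hrun.inner_end k).2.2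
  have h2 := D_toReal_le_v hglobal hqp (left_mem_Icc.2 hk.le)
    (hsolver.dual_feasible k _ le_rfl).2 (D_wIn_ne_bot hglobal hsolver (k := k) le_rfl 0)
  have h3 := max_le h2 (P.v_nonneg (T.x k))
  have h4 := hrun.omega_pos k
  have h5 : 0 < p.βv * (P.v (T.x k) + T.ω k -
      max ((T.qp P X k).D (T.wIn k (T.jEnd k)) 0).toReal 0) :=
    mul_pos p.βv_mem.1 (by linarith)
  rw [deltaL_zero_eq, d]
  linarith

/-- The effect of the posterior strategy. -/
theorem psst (hrun : T.IsRun P X p) (hglobal : T.GlobalAssumption P X)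
    (hqp : T.SubproblemAssumption P X p) (hsolver : T.SolverAssumption P X) {k : ℕ}
    (hk : 0 < T.ρprev p k) :
    T.ρ k = T.ρtilde k ∨ (¬ T.DustAfter P X p k (T.ρtilde k) ∧ 0 < T.ρ k ∧
      T.ρ k ≤ T.ρtilde k ∧ 0 < inner ℝ (gradient P.f (T.x k)) (T.d k)) := by
  by_cases h : T.DustAfter P X p k (T.ρtilde k)
  · exact Or.inl (hrun.psst_keep k h)
  · right
    obtain ⟨r, hr, hρ⟩ := hrun.psst_update k h
    have hpos := deltaL_add_omega_pos hrun hglobal hqp hsolver hk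
    have hq := quad_nonneg (hqp.posDef k r hr) (T.d k)
    have ht : T.ρtilde k ∈ Ioc 0 (T.ρprev p k) := hrun.ρIn_mem hk _ le_rfl
    set δ := (T.qp P X k).deltaL (T.d k) 0 + T.ω k with hδ
    have hβ : p.βl < 1 := by
      refine p.βl_mem.2.trans_lt ?_
      have h1 := p.βv_mem; have h2 := p.βφ_mem
      have := mul_lt_mul'' h2.2 (show 1 - p.βv < 1 by linarith [h1.1]) h2.1.le
        (by linarith [h1.2])
      linarith
    -- Failure of the reduction test, rewritten with `Δl(d, ρ) = Δl(d, 0) - ρ⟨g, d⟩`. It forces `⟨g,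
    -- d⟩ > 0` and puts the PSST quotient below `ρtilde`.
    have hg : (1 - p.βl) * δ < T.ρtilde k * inner ℝ (gradient P.f (T.x k)) (T.d k) := by
      have h1 := not_le.1 h
      rw [QP.deltaL_eq] at h1
      have h2 : (T.qp P X k).g = gradient P.f (T.x k) := rfl
      rw [h2] at h1
      linarith
    have hnum : 0 < (1 - p.βl) * δ := mul_pos (by linarith) hpos
    have hgd : 0 < inner ℝ (gradient P.f (T.x k)) (T.d k) :=
      pos_of_mul_pos_right (hnum.trans hg) ht.1.le
    refine ⟨h, ?_, ?_, hgd⟩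
    · rw [hρ]; positivity
    · rw [hρ, div_le_iff₀ (by positivity)]
      have : 0 ≤ T.ρtilde k * (1 / 2 * quad ((T.qp P X k).H r) (T.d k)) :=
        mul_nonneg ht.1.le (by positivity)
      linarith

theorem ρ_mem_of_ρprev_pos (hrun : T.IsRun P X p) (hglobal : T.GlobalAssumption P X)
    (hqp : T.SubproblemAssumption P X p) (hsolver : T.SolverAssumption P X) {k : ℕ}
    (hk : 0 < T.ρprev p k) : T.ρ k ∈ Ioc 0 (T.ρtilde k) := by
  have ht : T.ρtilde k ∈ Ioc 0 (T.ρprev p k) := hrun.ρIn_mem hk _ le_rfl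
  rcases psst hrun hglobal hqp hsolver hk with h | h
  · rw [h]; exact ⟨ht.1, le_rfl⟩
  · exact ⟨h.2.1, h.2.2.1⟩

theorem ρprev_pos (hrun : T.IsRun P X p) (hglobal : T.GlobalAssumption P X)
    (hqp : T.SubproblemAssumption P X p) (hsolver : T.SolverAssumption P X) (k : ℕ) :
    0 < T.ρprev p k := by
  induction k with
  | zero => exact p.ρinit_pos
  | succ k ih => exact (ρ_mem_of_ρprev_pos hrun hglobal hqp hsolver ih).1

theorem ρ_mem (hrun : T.IsRun P X p) (hglobal : T.GlobalAssumption P X)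
    (hqp : T.SubproblemAssumption P X p) (hsolver : T.SolverAssumption P X) (k : ℕ) :
    T.ρ k ∈ Ioc 0 (T.ρtilde k) :=
  ρ_mem_of_ρprev_pos hrun hglobal hqp hsolver (ρprev_pos hrun hglobal hqp hsolver k)

theorem ρtilde_mem (hrun : T.IsRun P X p) (hglobal : T.GlobalAssumption P X)
    (hqp : T.SubproblemAssumption P X p) (hsolver : T.SolverAssumption P X) (k : ℕ) :
    T.ρtilde k ∈ Ioc 0 (T.ρprev p k) :=
  hrun.ρIn_mem (ρprev_pos hrun hglobal hqp hsolver k) _ le_rfl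

theorem ρ_antitone (hrun : T.IsRun P X p) (hglobal : T.GlobalAssumption P X)
    (hqp : T.SubproblemAssumption P X p) (hsolver : T.SolverAssumption P X) : Antitone T.ρ :=
  antitone_nat_of_succ_le fun k => (ρ_mem hrun hglobal hqp hsolver (k + 1)).2.trans
    (ρtilde_mem hrun hglobal hqp hsolver (k + 1)).2

/-- The eigenvalue bounds cover only `[0, ρ_0]`, and `ρ_{-1}` may be larger; this is why the
estimates below start at `k = 1`. -/
theorem ρprev_le (hrun : T.IsRun P X p) (hglobal : T.GlobalAssumption P X)
    (hqp : T.SubproblemAssumption P X p) (hsolver : T.SolverAssumption P X) {k : ℕ}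
    (hk : 1 ≤ k) : T.ρprev p k ≤ T.ρ 0 := by
  obtain ⟨k, rfl⟩ := Nat.exists_eq_add_of_le' hk
  exact ρ_antitone hrun hglobal hqp hsolver (Nat.zero_le k)

theorem tendsto_ρprev {r : ℝ} (h : Tendsto T.ρ atTop (𝓝 r)) :
    Tendsto (T.ρprev p) atTop (𝓝 r) :=
  (tendsto_add_atTop_iff_nat 1).1 h

theorem tendsto_ρtilde (hrun : T.IsRun P X p) (hglobal : T.GlobalAssumption P X)
    (hqp : T.SubproblemAssumption P X p) (hsolver : T.SolverAssumption P X) {r : ℝ}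
    (h : Tendsto T.ρ atTop (𝓝 r)) : Tendsto T.ρtilde atTop (𝓝 r) :=
  tendsto_of_tendsto_of_tendsto_of_le_of_le h (tendsto_ρprev (p := p) h)
    (fun k => (ρ_mem hrun hglobal hqp hsolver k).2)
    (fun k => (ρtilde_mem hrun hglobal hqp hsolver k).2)

/-- The predicted reduction is bounded below by a multiple of `‖d‖²`. -/
theorem exists_mul_norm_sq_le_deltaL (hrun : T.IsRun P X p) (hglobal : T.GlobalAssumption P X)
    (hqp : T.SubproblemAssumption P X p) (hsolver : T.SolverAssumption P X) :
    ∃ c > 0, ∀ k, 1 ≤ k → c * ‖T.d k‖ ^ 2 ≤ (T.qp P X k).deltaL (T.d k) (T.ρ k) := by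
  obtain ⟨lo, hi, hlo, -, hspec⟩ := hglobal.eigenvalues
  refine ⟨1 / 2 * lo, by positivity, fun k hk => ?_⟩
  have ht := ρtilde_mem hrun hglobal hqp hsolver k
  have h1 : lo * ‖T.d k‖ ^ 2 ≤ quad ((T.qp P X k).H (T.ρtilde k)) (T.d k) :=
    mul_norm_sq_le_quad (hqp.posDef k _ (Ioc_subset_Icc_self ht)).isHermitian
      (fun t h => (hspec k _ ⟨ht.1.le, ht.2.trans (ρprev_le hrun hglobal hqp hsolver hk)⟩ h).1) _
  have h2 : 1 / 2 * quad ((T.qp P X k).H (T.ρtilde k)) (T.d k) ≤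
      (T.qp P X k).deltaL (T.d k) (T.ρtilde k) := half_quad_le_deltaL hsolver hglobal le_rfl
  -- A proper PSST reduction occurs only with `⟨g, d⟩ > 0`, and then lowering `ρ` raises `Δl`.
  have h3 : (T.qp P X k).deltaL (T.d k) (T.ρtilde k) ≤ (T.qp P X k).deltaL (T.d k) (T.ρ k) := by
    rcases psst hrun hglobal hqp hsolver (ρprev_pos hrun hglobal hqp hsolver k) with h | h
    · rw [h]
    · rw [QP.deltaL_eq, QP.deltaL_eq _ _ (T.ρ k)]
      have : T.ρ k * inner ℝ (gradient P.f (T.x k)) (T.d k) ≤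
        T.ρtilde k * inner ℝ (gradient P.f (T.x k)) (T.d k) :=
        mul_le_mul_of_nonneg_right h.2.2.1 h.2.2.2.le
      have h4 : (T.qp P X k).g = gradient P.f (T.x k) := rfl
      rw [h4]
      linarith
  linarith

/-! ### Global convergence of the line search -/

/-- The model `Δl` is accurate to second order. -/
theorem exists_phi_sub_le (hglobal : T.GlobalAssumption P X) :
    ∃ C : ℝ, ∀ k, ∀ ρ ∈ Icc 0 (T.ρ 0), ∀ a ∈ Icc (0 : ℝ) 1,
      P.phi (T.x k + a • T.d k) ρ - P.phi (T.x k) ρ ≤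
        -(a * (T.qp P X k).deltaL (T.d k) ρ) + C * a ^ 2 * ‖T.d k‖ ^ 2 := by
  obtain ⟨U, M, hU, hM, hmem, hf, hc⟩ := hglobal.exists_bound
  refine ⟨(T.ρ 0 + m) * M, fun k ρ hρ a ha => ?_⟩
  obtain ⟨hx, hxd⟩ := hmem k
  have h1 := (abs_le.1 (abs_taylor_le (P.f_smooth.differentiable one_ne_zero) hU hf.diff
    hf.norm_fderiv_le hx hxd ha.1 ha.2)).2
  have hE : 0 ≤ M * a ^ 2 * ‖T.d k‖ ^ 2 := by positivity
  have h2 := (mul_le_mul_of_nonneg_left h1 hρ.1).trans (mul_le_mul_of_nonneg_right hρ.2 hE)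
  have h3 : P.v (T.x k + a • T.d k) ≤
      (1 - a) * P.v (T.x k) + a * (T.qp P X k).l (T.d k) 0 + m * (M * a ^ 2 * ‖T.d k‖ ^ 2) := by
    rw [QP.l_eq, zero_mul, zero_add, NLP.v_eq, NLP.v_eq, Finset.mul_sum, Finset.mul_sum]
    have hconst : (m : ℝ) * (M * a ^ 2 * ‖T.d k‖ ^ 2) =
        ∑ _i : Fin m, M * a ^ 2 * ‖T.d k‖ ^ 2 := by
      rw [Finset.sum_const, Finset.card_univ, Fintype.card_fin, nsmul_eq_mul]
    rw [hconst, ← Finset.sum_add_distrib, ← Finset.sum_add_distrib]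
    refine Finset.sum_le_sum fun i _ => ?_
    have h4 := abs_taylor_le ((P.c_smooth i).differentiable one_ne_zero) hU (hc i).diff
      (hc i).norm_fderiv_le hx hxd ha.1 ha.2
    have h5 := viol_le_add_abs_sub (P.IsEq i) (P.c i (T.x k + a • T.d k))
      (P.c i (T.x k) + a * inner ℝ (gradient (P.c i) (T.x k)) (T.d k))
    have h6 := viol_convex (P.IsEq i) (P.c i (T.x k))
      (inner ℝ (gradient (P.c i) (T.x k)) (T.d k)) ha.1 ha.2
    exact h5.trans (add_le_add h6 h4)
  rw [QP.deltaL_eq, deltaL_zero_eq]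
  have hg : (T.qp P X k).g = gradient P.f (T.x k) := rfl
  rw [hg]
  unfold NLP.phi
  linarith

theorem exists_le_α (hrun : T.IsRun P X p) (hglobal : T.GlobalAssumption P X)
    (hqp : T.SubproblemAssumption P X p) (hsolver : T.SolverAssumption P X) :
    ∃ a > 0, ∀ k, 1 ≤ k → a ≤ T.α k := by
  obtain ⟨C, hC⟩ := exists_phi_sub_le hglobal
  obtain ⟨c, hc, hdl⟩ := exists_mul_norm_sq_le_deltaL hrun hglobal hqp hsolver
  have hB : 0 < (1 - p.θα) * c := mul_pos (sub_pos.2 p.θα_mem.2) hc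
  -- Once `C γ^i ≤ (1 - θ_α) c`, the second-order error is absorbed by `(1 - θ_α) Δl`, so `γ^i` is
  -- acceptable and the line search returns at least this value.
  obtain ⟨i, hi⟩ := exists_pow_lt_of_lt_one (show 0 < (1 - p.θα) * c / (|C| + 1) by positivity)
    p.γ_mem.2
  have hγ : 0 < p.γ ^ i := pow_pos p.γ_mem.1 i
  refine ⟨p.γ ^ i, hγ, fun k hk => (hrun.line_search k).2 ⟨⟨i, rfl⟩, ?_⟩⟩
  have hρ : T.ρ k ∈ Icc 0 (T.ρ 0) := ⟨(ρ_mem hrun hglobal hqp hsolver k).1.le,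
    ρ_antitone hrun hglobal hqp hsolver (Nat.zero_le k)⟩
  refine (hC k _ hρ _ ⟨hγ.le, pow_le_one₀ p.γ_mem.1.le p.γ_mem.2.le⟩).trans ?_
  have h1 : C * p.γ ^ i ≤ (1 - p.θα) * c := by
    rw [lt_div_iff₀ (by positivity)] at hi
    have h2 : C * p.γ ^ i ≤ |C| * p.γ ^ i := mul_le_mul_of_nonneg_right (le_abs_self C) hγ.le
    linarith
  have h3 : C * p.γ ^ i * ‖T.d k‖ ^ 2 ≤ (1 - p.θα) * (T.qp P X k).deltaL (T.d k) (T.ρ k) := by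
    refine (mul_le_mul_of_nonneg_right h1 (sq_nonneg _)).trans ?_
    rw [mul_assoc]
    exact mul_le_mul_of_nonneg_left (hdl k hk) (sub_pos.2 p.θα_mem.2).le
  have h4 := mul_le_mul_of_nonneg_left h3 hγ.le
  linarith

/-- The shifted merit function converges along the iterates and the steps tend to zero. -/
theorem exists_tendsto_merit (hrun : T.IsRun P X p) (hglobal : T.GlobalAssumption P X)
    (hqp : T.SubproblemAssumption P X p) (hsolver : T.SolverAssumption P X) :
    ∃ M L : ℝ, (∀ k, |P.f (T.x k)| ≤ M) ∧
      Tendsto (fun k => T.ρ k * (P.f (T.x k) + M) + P.v (T.x k)) atTop (𝓝 L) ∧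
      Tendsto (fun k => ‖T.d k‖) atTop (𝓝 0) := by
  obtain ⟨U, M, -, -, hmem, hf, -⟩ := hglobal.exists_bound
  have hfM : ∀ k, |P.f (T.x k)| ≤ M := fun k => hf.abs_le _ (hmem k).1
  obtain ⟨a, ha, hα⟩ := exists_le_α hrun hglobal hqp hsolver
  obtain ⟨c, hc, hdl⟩ := exists_mul_norm_sq_le_deltaL hrun hglobal hqp hsolver
  have hρ := ρ_mem hrun hglobal hqp hsolver
  have hanti := ρ_antitone hrun hglobal hqp hsolver
  -- The shift makes `f + M ≥ 0`, so that lowering `ρ` cannot increase `Ψ`.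
  set Ψ : ℕ → ℝ := fun k => T.ρ k * (P.f (T.x k) + M) + P.v (T.x k) with hΨ
  have hθ := p.θα_mem.1
  have hstep : ∀ k, 1 ≤ k → p.θα * a * c * ‖T.d k‖ ^ 2 ≤ Ψ k - Ψ (k + 1) := by
    intro k hk
    have h1 := (hrun.line_search k).1.2
    rw [← hrun.x_succ] at h1
    have h2 : T.ρ (k + 1) * (P.f (T.x (k + 1)) + M) ≤ T.ρ k * (P.f (T.x (k + 1)) + M) :=
      mul_le_mul_of_nonneg_right (hanti (Nat.le_succ k))
        (by linarith [(abs_le.1 (hfM (k + 1))).1])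
    have h3 : p.θα * a * (c * ‖T.d k‖ ^ 2) ≤
        p.θα * T.α k * (T.qp P X k).deltaL (T.d k) (T.ρ k) := by
      have hαk := hα k hk
      have hα0 := ha.trans_le hαk
      exact mul_le_mul (mul_le_mul_of_nonneg_left hαk hθ.le) (hdl k hk) (by positivity)
        (by positivity)
    unfold NLP.phi at h1
    simp only [hΨ]
    linarith
  have hΨ0 : ∀ k, 0 ≤ Ψ k := fun k =>
    add_nonneg (mul_nonneg (hρ k).1.le (by linarith [(abs_le.1 (hfM k)).1])) (P.v_nonneg _)
  have hΨanti : Antitone fun k => Ψ (k + 1) := antitone_nat_of_succ_le fun k => by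
    have h1 := hstep (k + 1) (Nat.le_add_left 1 k)
    have h2 : 0 ≤ p.θα * a * c * ‖T.d (k + 1)‖ ^ 2 := by positivity
    linarith
  have hlim := tendsto_atTop_ciInf hΨanti ⟨0, by rintro _ ⟨k, rfl⟩; exact hΨ0 _⟩
  have hlim' := (tendsto_add_atTop_iff_nat (f := Ψ) 1).1 hlim
  refine ⟨M, _, hfM, hlim', ?_⟩
  have hdiff : Tendsto (fun k => Ψ k - Ψ (k + 1)) atTop (𝓝 0) := by
    simpa using hlim'.sub hlim
  have hcoef : 0 < p.θα * a * c := by positivity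
  have hsqrt : Tendsto (fun k => Real.sqrt ((p.θα * a * c)⁻¹ * (Ψ k - Ψ (k + 1)))) atTop
      (𝓝 0) := by
    simpa using (hdiff.const_mul (p.θα * a * c)⁻¹).sqrt
  refine squeeze_zero' (Eventually.of_forall fun _ => norm_nonneg _) ?_ hsqrt
  filter_upwards [eventually_ge_atTop 1] with k hk
  refine Real.le_sqrt_of_sq_le ?_
  rw [← div_eq_inv_mul, le_div_iff₀' hcoef]
  exact hstep k hk

theorem exists_deltaL_le (hglobal : T.GlobalAssumption P X) :
    ∃ B : ℝ, ∀ k, ∀ ρ ∈ Icc 0 (T.ρ 0), (T.qp P X k).deltaL (T.d k) ρ ≤ B * ‖T.d k‖ := by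
  obtain ⟨U, M, -, hM, hmem, hf, hc⟩ := hglobal.exists_bound
  refine ⟨(T.ρ 0 + m) * M, fun k ρ hρ => ?_⟩
  refine ((T.qp P X k).deltaL_le (hf.norm_gradient_le _ (hmem k).1)
    (fun i => (hc i).norm_gradient_le _ (hmem k).1) _ hρ.1).trans ?_
  have := hρ.2
  gcongr

/-- As `f` is bounded along the iterates, the objective part of the merit function disappears when
`ρ_k → 0`. -/
theorem exists_tendsto_v (hrun : T.IsRun P X p) (hglobal : T.GlobalAssumption P X)
    (hqp : T.SubproblemAssumption P X p) (hsolver : T.SolverAssumption P X)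
    (h : Tendsto T.ρ atTop (𝓝 0)) : ∃ L, Tendsto (fun k => P.v (T.x k)) atTop (𝓝 L) := by
  obtain ⟨M, L, hM, hL, -⟩ := exists_tendsto_merit hrun hglobal hqp hsolver
  refine ⟨L, ?_⟩
  have h1 : Tendsto (fun k => T.ρ k * (P.f (T.x k) + M)) atTop (𝓝 0) := by
    have h2 : Tendsto (fun k => T.ρ k * (M + M)) atTop (𝓝 0) := by
      simpa using h.mul_const (M + M)
    refine squeeze_zero (fun k => mul_nonneg (ρ_mem hrun hglobal hqp hsolver k).1.le ?_)
      (fun k => mul_le_mul_of_nonneg_left ?_ (ρ_mem hrun hglobal hqp hsolver k).1.le) h2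
    · linarith [(abs_le.1 (hM k)).1]
    · linarith [(abs_le.1 (hM k)).2]
  simpa using hL.sub h1

/-! ### Limit points -/

theorem IsLimitPoint.exists_one_le {S : Set ℕ} {z : Vec n} (h : T.IsLimitPoint S z) :
    ∃ s : ℕ → ℕ, Tendsto s atTop atTop ∧ (∀ j, s j ∈ S) ∧ (∀ j, 1 ≤ s j) ∧
      Tendsto (fun j => T.x (s j)) atTop (𝓝 z) := by
  obtain ⟨s, hs, hS, hx⟩ := h
  refine ⟨fun j => s (j + 1), hs.tendsto_atTop.comp (tendsto_add_atTop_nat 1),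
    fun j => hS _, fun j => ?_, hx.comp (tendsto_add_atTop_nat 1)⟩
  exact (Nat.le_add_left 1 j).trans (hs.id_le (j + 1))

/-- Dual variables with vanishing duality gap accumulate at multipliers. -/
theorem exists_isMultiplier_of_gap (hrun : T.IsRun P X p) (hglobal : T.GlobalAssumption P X)
    (hqp : T.SubproblemAssumption P X p) (hsolver : T.SolverAssumption P X) {s : ℕ → ℕ}
    (hs : ∀ j, 1 ≤ s j) {z : Vec n} (hx : Tendsto (fun j => T.x (s j)) atTop (𝓝 z))
    {ρ : ℕ → ℝ} {r : ℝ} (hρ : ∀ j, ρ j ∈ Icc 0 (T.ρprev p (s j))) (hr : Tendsto ρ atTop (𝓝 r))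
    {w : ℕ → DualVar n m} (hw : ∀ j, (T.qp P X (s j)).DualFeasible (w j))
    (hD : ∀ j, (T.qp P X (s j)).D (w j) (ρ j) ≠ ⊥) {ε : ℕ → ℝ} (hε : Tendsto ε atTop (𝓝 0))
    (hgap : ∀ᶠ j in atTop,
      P.v (T.x (s j)) - ((T.qp P X (s j)).D (w j) (ρ j)).toReal ≤ ε j) :
    ∃ ζ : Fin m → ℝ, P.IsMultiplier z r ζ ∧ ∃ φ : ℕ → ℕ, StrictMono φ ∧
      Tendsto (fun j => (T.qp P X (s (φ j))).zeta (w (φ j))) atTop (𝓝 ζ) := by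
  obtain ⟨τ, hτ, hX⟩ := hglobal.exists_closedBall_subset
  obtain ⟨lo, hi, hlo, hlohi, hspec⟩ := hglobal.eigenvalues
  have hhi := hlo.trans_le hlohi
  have hgap0 : Tendsto (fun j => P.v (T.x (s j)) -
      ((T.qp P X (s j)).D (w j) (ρ j)).toReal) atTop (𝓝 0) :=
    squeeze_zero' (Eventually.of_forall fun j =>
      sub_nonneg.2 (D_toReal_le_v hglobal hqp (hρ j) (hw j) (hD j))) hgap hε
  -- Here `κ` comes from the lower bound `1 / hi` for the inverse Hessian and `τ` from the ball
  -- contained in `X`.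
  refine P.exists_tendsto_isMultiplier hx hr hgap0 (κ := 1 / 2 * hi⁻¹) (τ := τ) (by positivity) hτ
    (p := fun j => (w j).u0 - ρ j • gradient P.f (T.x (s j))) (q := fun j => (w j).uX)
    (ζ := fun j => (T.qp P X (s j)).zeta (w j)) (fun j i => ?_) (fun j i => ?_) (fun j => ?_)
    (fun j => ?_)
  · exact (T.qp P X (s j)).abs_zeta_le_one (w j) (hglobal.norm_a_pos _ i) ((hw j).2 i)
  · exact (T.qp P X (s j)).zeta_nonneg_of_supportFn_ne_top (w j) (hglobal.norm_a_pos _ i)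
      (((T.qp P X (s j)).finite_of_D_ne_bot (hglobal.norm_a_pos _) (hD j)).1 i)
  · rw [sub_add_cancel]
    exact (T.qp P X (s j)).dualFeasible_zeta (hglobal.norm_a_pos _) (hD j) (hw j)
  · have h1 := (T.qp P X (s j)).D_toReal_le (hglobal.norm_a_pos _) (hD j) hτ.le hX
    have h2 : hi⁻¹ * ‖(w j).u0 - ρ j • gradient P.f (T.x (s j))‖ ^ 2 ≤
        quad ((T.qp P X (s j)).H (ρ j))⁻¹ ((w j).u0 - ρ j • (T.qp P X (s j)).g) :=
      mul_norm_sq_le_quad_inv (hqp.posDef _ _ (hρ j)) (fun t ht => (hspec _ _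
        ⟨(hρ j).1, (hρ j).2.trans (ρprev_le hrun hglobal hqp hsolver (hs j))⟩ ht).2) _
    have h3 : ∑ i, (T.qp P X (s j)).zeta (w j) i * (T.qp P X (s j)).b i =
      ∑ i, (T.qp P X (s j)).zeta (w j) i * P.c i (T.x (s j)) := rfl
    linarith

/-- Infeasible limit points are stationary for the measure of infeasibility. -/
theorem isStationaryForV_of_isLimitPoint (hrun : T.IsRun P X p) (hglobal : T.GlobalAssumption P X)
    (hqp : T.SubproblemAssumption P X p) (hsolver : T.SolverAssumption P X) {z : Vec n}
    (hz : T.IsLimitPoint univ z) (hinf : ¬ P.Feasible z) : P.IsStationaryForV z := by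
  obtain ⟨s, hs, -, hs1, hx⟩ := hz.exists_one_le
  obtain ⟨M, L, -, -, hd⟩ := exists_tendsto_merit hrun hglobal hqp hsolver
  obtain ⟨B, hB⟩ := exists_deltaL_le hglobal
  have hρp := ρprev_pos hrun hglobal hqp hsolver
  have hvz : 0 < P.v z :=
    lt_of_le_of_ne (P.v_nonneg z) fun h => hinf ((P.feasible_iff z).2 h.symm)
  have hε : Tendsto (fun j => p.βv⁻¹ * (B * ‖T.d (s j)‖ + T.ω (s j))) atTop (𝓝 0) := by
    simpa using (((hd.comp hs).const_mul B).add (hrun.tendsto_omega.comp hs)).const_mul p.βv⁻¹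
  have hv := (P.continuous_v.tendsto z).comp hx
  have hbound : ∀ j, P.v (T.x (s j)) -
      max ((T.qp P X (s j)).D (T.wIn (s j) (T.jEnd (s j))) 0).toReal 0 ≤
        p.βv⁻¹ * (B * ‖T.d (s j)‖ + T.ω (s j)) := by
    intro j
    have h1 := (Rv_iff hrun hglobal hqp hsolver (hρp (s j)) le_rfl).1
      (hrun.inner_end (s j)).2.2
    have h2 := hB (s j) 0 ⟨le_rfl, (ρ_mem hrun hglobal hqp hsolver 0).1.le⟩
    rw [deltaL_zero_eq] at h2
    have h3 := hrun.omega_pos (s j)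
    have h4 := mul_pos p.βv_mem.1 h3
    rw [← div_eq_inv_mul, le_div_iff₀' p.βv_mem.1]
    unfold d at h2 ⊢
    linarith
  obtain ⟨ζ, hζ, -⟩ := exists_isMultiplier_of_gap hrun hglobal hqp hsolver hs1 hx
    (ρ := fun _ => 0) (r := 0) (fun j => left_mem_Icc.2 (hρp _).le) tendsto_const_nhds
    (w := fun j => T.wIn (s j) (T.jEnd (s j)))
    (fun j => (hsolver.dual_feasible _ _ le_rfl).2)
    (fun j => D_wIn_ne_bot hglobal hsolver le_rfl 0) hε (by
      -- (Rv) involves only the positive part of `D`. Near the infeasible point `z` one has `v >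
      -- v(z) / 2`, while the gap is eventually smaller than that, so `D` is positive and equals its
      -- positive part.
      filter_upwards [hv.eventually (lt_mem_nhds (half_lt_self hvz)),
        hε.eventually (gt_mem_nhds (half_pos hvz))] with j hj1 hj2
      have h1 := hbound j
      have h2 : P.v z / 2 < P.v (T.x (s j)) := hj1
      rcases le_total ((T.qp P X (s j)).D (T.wIn (s j) (T.jEnd (s j))) 0).toReal 0 with h | h
      · rw [max_eq_right h] at h1; linarith
      · rwa [max_eq_left h] at h1)
  exact hζ.isStationaryForV

/-- If the penalty parameters stay away from zero, feasible limit points are KKT points. -/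
theorem isKKT_of_isLimitPoint (hrun : T.IsRun P X p) (hglobal : T.GlobalAssumption P X)
    (hqp : T.SubproblemAssumption P X p) (hsolver : T.SolverAssumption P X) {r : ℝ} (hr : 0 < r)
    (hρ : Tendsto T.ρ atTop (𝓝 r)) {z : Vec n} (hz : T.IsLimitPoint univ z)
    (hfeas : P.Feasible z) : P.IsKKT z := by
  obtain ⟨s, hs, -, hs1, hx⟩ := hz.exists_one_le
  obtain ⟨M, L, -, -, hd⟩ := exists_tendsto_merit hrun hglobal hqp hsolver
  obtain ⟨B, hB⟩ := exists_deltaL_le hglobal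
  have hρp := ρprev_pos hrun hglobal hqp hsolver
  have hρt := ρtilde_mem hrun hglobal hqp hsolver
  have hε : Tendsto (fun j => p.βφ⁻¹ * (B * ‖T.d (s j)‖ + T.ω (s j))) atTop (𝓝 0) := by
    simpa using (((hd.comp hs).const_mul B).add (hrun.tendsto_omega.comp hs)).const_mul p.βφ⁻¹
  obtain ⟨ζ, hζ, -⟩ := exists_isMultiplier_of_gap hrun hglobal hqp hsolver hs1 hx
    (ρ := fun j => T.ρtilde (s j)) (fun j => Ioc_subset_Icc_self (hρt _))
    ((tendsto_ρtilde hrun hglobal hqp hsolver hρ).comp hs)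
    (w := fun j => T.uIn (s j) (T.jEnd (s j)))
    (fun j => (hsolver.dual_feasible _ _ le_rfl).1)
    (fun j => D_uIn_ne_bot hglobal hsolver le_rfl _) hε (Eventually.of_forall fun j => by
      have h1 := (Rphi_iff hrun hglobal hqp hsolver (hρp (s j)) le_rfl).1
        (hrun.inner_end (s j)).1
      have h2 := hB (s j) (T.ρtilde (s j)) ⟨(hρt (s j)).1.le,
        (hρt (s j)).2.trans (ρprev_le hrun hglobal hqp hsolver (hs1 j))⟩
      rw [deltaL_zero_eq] at h2
      have h3 := quad_nonneg (hqp.posDef _ _ (Ioc_subset_Icc_self (hρt (s j)))) (T.d (s j))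
      have h4 := mul_pos p.βφ_mem.1 (hrun.omega_pos (s j))
      rw [← div_eq_inv_mul, le_div_iff₀' p.βφ_mem.1]
      unfold d ρtilde at *
      linarith)
  exact hζ.isKKT hr hfeas

/-! ### Reductions of the penalty parameter -/

/-- In an iteration that reduces the penalty parameter there is a dual variable with an almost
nonnegative dual value and a multiplier that is bounded away from zero. -/
theorem exists_large_zeta (hrun : T.IsRun P X p) (hglobal : T.GlobalAssumption P X)
    (hqp : T.SubproblemAssumption P X p) (hsolver : T.SolverAssumption P X) :
    ∃ B : ℝ, ∀ k ∈ T.setD P X p ∪ T.setT, ∃ ρ ∈ Icc 0 (T.ρprev p k), ∃ w : DualVar n m,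
      (T.qp P X k).DualFeasible w ∧ (T.qp P X k).D w ρ ≠ ⊥ ∧
      -((T.qp P X k).D w ρ).toReal ≤ p.βφ⁻¹ * (P.v (T.x k) + T.ω k + B * T.ρprev p k) ∧
      ∃ i, p.βv ≤ |(T.qp P X k).zeta w i| := by
  obtain ⟨U, M, -, hM, hmem, hf, -⟩ := hglobal.exists_bound
  obtain ⟨R, hR⟩ := hglobal.X_compact.isBounded.exists_norm_le
  have hR0 : 0 ≤ R := (norm_nonneg _).trans (hR 0 (interior_subset hglobal.zero_mem))
  have hβv := p.βv_mem
  have hβφ := p.βφ_mem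
  refine ⟨M * R, fun k hk => ?_⟩
  have hρp := ρprev_pos hrun hglobal hqp hsolver k
  have hv := P.v_nonneg (T.x k)
  have hω := hrun.omega_pos k
  have hMR : 0 ≤ M * R * T.ρprev p k := by positivity
  rcases hk with ⟨j, hj, hphi, hRc, hRv⟩ | hk
  · have hρ := hrun.ρIn_mem hρp j hj
    have hDb := D_uIn_ne_bot hglobal hsolver hj (T.ρIn k j)
    refine ⟨T.ρIn k j, Ioc_subset_Icc_self hρ, T.uIn k j, (hsolver.dual_feasible k j hj).1, hDb,
      ?_, ?_⟩
    · have h1 := (Rphi_iff hrun hglobal hqp hsolver hρp hj).1 hphi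
      have h2 := quad_nonneg (hqp.posDef _ _ (Ioc_subset_Icc_self hρ)) (T.dIn k j)
      -- The linearized violation is nonnegative, and compactness of `X` bounds the objective part
      -- of the model by a multiple of `ρ`.
      have h3 : -(M * R * T.ρprev p k) ≤ (T.qp P X k).l (T.dIn k j) (T.ρIn k j) := by
        rw [QP.l_zero_add_mul]
        have h4 := (T.qp P X k).l_zero_nonneg (T.dIn k j)
        have h5 : -(M * R) ≤ inner ℝ (T.qp P X k).g (T.dIn k j) := by
          refine (abs_le.1 ((abs_real_inner_le_norm _ _).trans ?_)).1
          exact mul_le_mul (hf.norm_gradient_le _ (hmem k).1)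
            (hR _ (hsolver.primal_mem k j hj)) (norm_nonneg _) hM
        have h6 := mul_le_mul_of_nonneg_left h5 hρ.1.le
        have h7 := mul_le_mul_of_nonneg_left hρ.2 (mul_nonneg hM hR0)
        linarith
      have h8 : 0 ≤ p.βφ * (P.v (T.x k) + T.ω k) := mul_nonneg hβφ.1.le (by linarith)
      rw [← div_eq_inv_mul, le_div_iff₀' hβφ.1]
      linarith
    -- DUST case: if all `|ζ_i| < β_v`, then (Rc) gives `(1 - β_v) l(d, 0) ≤ χ ≤ (1 - β_v)² J_ω`.
    -- Hence `J_ω - l(d, 0) ≥ β_v J_ω`, and (Rv) would hold.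
    · by_contra! hlt
      rw [Rv_iff hrun hglobal hqp hsolver hρp hj, not_le] at hRv
      have h1 := (T.qp P X k).mul_l_le_chi (hglobal.norm_a_pos k) (w := T.uIn k j)
        (d := T.dIn k j) (β := 1 - p.βv) (by linarith [hβv.2])
        (fun i => by rw [sub_sub_cancel]; exact (hlt i).le)
      have h2 := h1.trans hRc
      rw [qp_Jzero, pow_two, mul_assoc] at h2
      have h3 := le_of_mul_le_mul_left h2 (sub_pos.2 hβv.2)
      have h4 : 0 ≤ p.βv * max ((T.qp P X k).D (T.wIn k j) 0).toReal 0 :=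
        mul_nonneg hβv.1.le (le_max_right _ _)
      linarith
  · have hρ := ρtilde_mem hrun hglobal hqp hsolver k
    have hDb : (T.qp P X k).D (T.uIn k (T.jEnd k)) (T.ρtilde k) ≠ ⊥ :=
      D_uIn_ne_bot hglobal hsolver le_rfl _
    have hfe := (hsolver.dual_feasible k _ le_rfl).1
    have hlt : T.ρ k < T.ρtilde k := hk
    have hdust := ((psst hrun hglobal hqp hsolver hρp).resolve_left hlt.ne).1
    have h1 := (Rphi_iff hrun hglobal hqp hsolver hρp le_rfl).1 (hrun.inner_end k).1
    have h2 := quad_nonneg (hqp.posDef _ _ (Ioc_subset_Icc_self hρ)) (T.d k)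
    have h3 := not_le.1 hdust
    have h4 := deltaL_add_omega_pos hrun hglobal hqp hsolver hρp
    have h5 := mul_le_mul_of_nonneg_right p.βl_mem.2 h4.le
    have h6 := (T.qp P X k).l_zero_nonneg (T.d k)
    rw [deltaL_zero_eq] at h3 h4 h5
    rw [deltaL_zero_eq] at h3
    -- PSST case: (Rφ), the failed reduction test and `β_l ≤ β_φ (1 - β_v)` together give `D > β_v
    -- (v + ω)`. Multipliers smaller than `β_v` would only allow `D ≤ β_v v`.
    have h7 : p.βφ * (P.v (T.x k) + T.ω k -
        ((T.qp P X k).D (T.uIn k (T.jEnd k)) (T.ρtilde k)).toReal) <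
        p.βφ * ((1 - p.βv) * (P.v (T.x k) - (T.qp P X k).l (T.d k) 0 + T.ω k)) := by
      unfold d ρtilde at *
      linarith
    have h8 := lt_of_mul_lt_mul_left h7 hβφ.1.le
    have h9 : 0 ≤ (1 - p.βv) * (T.qp P X k).l (T.d k) 0 :=
      mul_nonneg (by linarith [hβv.2]) h6
    have h10 : p.βv * (P.v (T.x k) + T.ω k) <
        ((T.qp P X k).D (T.uIn k (T.jEnd k)) (T.ρtilde k)).toReal := by linarith
    have h11 : 0 ≤ p.βv * (P.v (T.x k) + T.ω k) := mul_nonneg hβv.1.le (by linarith)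
    refine ⟨T.ρtilde k, Ioc_subset_Icc_self hρ, _, hfe, hDb, ?_, ?_⟩
    · have : 0 ≤ p.βφ⁻¹ * (P.v (T.x k) + T.ω k + M * R * T.ρprev p k) :=
        mul_nonneg (inv_nonneg.2 hβφ.1.le) (by linarith)
      linarith
    · by_contra! hsmall
      have h12 := D_toReal_le_sum hglobal hqp (Ioc_subset_Icc_self hρ) hDb
      have h13 : ∑ i, (T.qp P X k).zeta (T.uIn k (T.jEnd k)) i * P.c i (T.x k) ≤
          p.βv * P.v (T.x k) := by
        rw [NLP.v_eq, Finset.mul_sum]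
        refine Finset.sum_le_sum fun i _ => (mul_le_abs_mul_viol (P.IsEq i)
          ((T.qp P X k).zeta_nonneg_of_supportFn_ne_top _ (hglobal.norm_a_pos k i)
            (((T.qp P X k).finite_of_D_ne_bot (hglobal.norm_a_pos k) hDb).1 i)) _).trans ?_
        exact mul_le_mul_of_nonneg_right (hsmall i).le (viol_nonneg _ _)
      have h14 := mul_pos hβv.1 hω
      linarith

/-- MFCQ fails at the limit points of the iterates at which the penalty parameter is reduced. -/
theorem not_mfcq_of_isLimitPoint (hrun : T.IsRun P X p) (hglobal : T.GlobalAssumption P X)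
    (hqp : T.SubproblemAssumption P X p) (hsolver : T.SolverAssumption P X)
    (hρ : Tendsto T.ρ atTop (𝓝 0)) (hv : Tendsto (fun k => P.v (T.x k)) atTop (𝓝 0)) {z : Vec n}
    (hz : T.IsLimitPoint (T.setD P X p ∪ T.setT) z) : ¬ P.MFCQ z := by
  intro hmfcq
  obtain ⟨s, hs, hS, hs1, hx⟩ := hz.exists_one_le
  obtain ⟨B, hB⟩ := exists_large_zeta hrun hglobal hqp hsolver
  choose ρ hρm w hw hD hneg i hi using fun j => hB (s j) (hS j)
  have hρp : Tendsto (fun j => T.ρprev p (s j)) atTop (𝓝 0) := (tendsto_ρprev hρ).comp hs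
  have hρ0 : Tendsto ρ atTop (𝓝 0) :=
    squeeze_zero (fun j => (hρm j).1) (fun j => (hρm j).2) hρp
  have hvs := hv.comp hs
  have hε : Tendsto (fun j => P.v (T.x (s j)) +
      p.βφ⁻¹ * (P.v (T.x (s j)) + T.ω (s j) + B * T.ρprev p (s j))) atTop (𝓝 0) := by
    have := hvs.add (((hvs.add (hrun.tendsto_omega.comp hs)).add
      (hρp.const_mul B)).const_mul p.βφ⁻¹)
    simpa using this
  obtain ⟨ζ, hζ, φ, -, hlim⟩ := exists_isMultiplier_of_gap hrun hglobal hqp hsolver hs1 hx hρm hρ0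
    hw hD hε (Eventually.of_forall fun j => by linarith [hneg j])
  have h0 : ζ = 0 := funext fun i => hζ.eq_zero_of_mfcq hmfcq i
  rw [h0] at hlim
  -- The index of the large multiplier may vary with `j`; summing over all indices avoids selecting
  -- a constant one.
  have h1 : Tendsto (fun j => ∑ i, |(T.qp P X (s (φ j))).zeta (w (φ j)) i|) atTop (𝓝 0) := by
    simpa using tendsto_finsetSum Finset.univ fun i _ => ((tendsto_pi_nhds.1 hlim) i).abs
  refine absurd (ge_of_tendsto' h1 fun j => ?_) (not_le.2 p.βv_mem.1)
  exact (hi (φ j)).trans (Finset.single_le_sum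
    (f := fun i => |(T.qp P X (s (φ j))).zeta (w (φ j)) i|) (fun _ _ => abs_nonneg _)
    (Finset.mem_univ _))

end Trajectory

end PenaltySQP

theorem mainTheorem4 {n m : ℕ} (P : PenaltySQP.NLP n m)
    (X : Set (PenaltySQP.Vec n)) (p : PenaltySQP.Params) (T : PenaltySQP.Trajectory n m)
    (hrun : T.IsRun P X p) (hqp : T.SubproblemAssumption P X p)
    (hsolver : T.SolverAssumption P X) (hglobal : T.GlobalAssumption P X) :
    (T.CaseI P ∨ T.CaseII P ∨ T.CaseIII P X p) ∧
    ¬ (T.CaseI P ∧ T.CaseII P) ∧ ¬ (T.CaseI P ∧ T.CaseIII P X p) ∧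
    ((∃ z, T.IsLimitPoint Set.univ z) → ¬ (T.CaseII P ∧ T.CaseIII P X p)) := by
  open PenaltySQP PenaltySQP.Trajectory in
  refine ⟨?_, ?_, ?_, ?_⟩
  · have hbdd : BddBelow (range T.ρ) :=
      ⟨0, by rintro _ ⟨k, rfl⟩; exact (ρ_mem hrun hglobal hqp hsolver k).1.le⟩
    have hlim := tendsto_atTop_ciInf (ρ_antitone hrun hglobal hqp hsolver) hbdd
    have hstat : ∀ z, T.IsLimitPoint univ z → ¬ P.Feasible z → P.IsInfeasibleStationary z :=
      fun z hz hinf => ⟨hinf, isStationaryForV_of_isLimitPoint hrun hglobal hqp hsolver hz hinf⟩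
    have hnn : 0 ≤ ⨅ k, T.ρ k :=
      le_ciInf fun k => (ρ_mem hrun hglobal hqp hsolver k).1.le
    rcases hnn.lt_or_eq with hpos | hzero
    · refine Or.inl ⟨⟨_, hpos, hlim⟩, fun z hz => ?_⟩
      by_cases hz' : P.Feasible z
      · exact Or.inl (isKKT_of_isLimitPoint hrun hglobal hqp hsolver hpos hlim hz hz')
      · exact Or.inr (hstat z hz hz')
    -- All limit points share the value `L = lim v(x^k)`, so they are all feasible or all
    -- infeasible.
    · rw [← hzero] at hlim
      obtain ⟨L, hL⟩ := exists_tendsto_v hrun hglobal hqp hsolver hlim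
      have hvz : ∀ z, T.IsLimitPoint univ z → P.v z = L := by
        rintro z ⟨s, hs, -, hx⟩
        exact tendsto_nhds_unique ((P.continuous_v.tendsto z).comp hx) (hL.comp hs.tendsto_atTop)
      by_cases hL0 : L = 0
      · rw [hL0] at hL hvz
        exact Or.inr (Or.inr ⟨hlim, fun z hz => (P.feasible_iff z).2 (hvz z hz),
          fun z hz => not_mfcq_of_isLimitPoint hrun hglobal hqp hsolver hlim hL hz⟩)
      · exact Or.inr (Or.inl ⟨hlim, fun z hz => hstat z hz fun hf =>
          hL0 ((hvz z hz).symm.trans ((P.feasible_iff z).1 hf))⟩)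
  · rintro ⟨⟨⟨r, hr, h1⟩, -⟩, h2, -⟩
    exact hr.ne' (tendsto_nhds_unique h1 h2)
  · rintro ⟨⟨⟨r, hr, h1⟩, -⟩, h2, -⟩
    exact hr.ne' (tendsto_nhds_unique h1 h2)
  · rintro ⟨z, hz⟩ ⟨⟨-, h1⟩, -, h2, -⟩
    exact (h1 z hz).1 (h2 z hz)
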